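/- **Setting.** Let $n,m\ge 1$. For $k\ge 0$ let $\mathcal S_k$ be the space of rapidly decreasing (Schwartz) functions $\mathbb R\to\mathbb R^k$ of the arclength $l$, $D_X=\partial_l$, and $D_X^{-1}f(l)=\tfrac12\big(\int_{-\infty}^{l}f-\int_{l}^{\infty}f\big)$, the antiderivative whose limits at $\pm\infty$ add up to $0$. For row vectors put $v\wedge\xi=v^T\xi-\xi^Tv$ and $A\rfloor(v\wedge\xi)=(A\cdot v)\,\xi-(A\cdot\xi)\,v$. For $v\in\mathcal S_k$ define the operators $\mathcal S_k\to\mathcal S_k$ $$J_vX=D_XX+D_X^{-1}(v\cdot X)\,v,\qquad H_v\xi=D_X\xi+v\rfloor D_X^{-1}(v\wedge\xi),\qquad \Re_v=H_v\circ J_v .$$ On $\mathcal S_{n-1}\times\mathcal S_{m-1}\ni(\overrightarrow v,\overleftarrow v)$ let $\mathcal J=(hJ,vJ)$, $\mathcal H=(hH,vH)$, $\Re=(h\Re,v\Re)$ be the pairs of these operators for $\overrightarrow v$ and $\overleftarrow v$, and let $\langle\cdot,\cdot\rangle$ be the sum of the two $L^2$ pairings. Write $A'_v[W]X$ for the derivative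 of $v\mapsto A_vX$ ($X$ fixed) in the direction $W$. Let $\mathrm{Dom}\,\mathcal H_v$ be the set of $\xi$ with $\int v\wedge\xi\,dl=0$ in both components (equivalently: $v\wedge\xi$ is the derivative of a rapidly decreasing function). **Geometry.** Let $V$ be a smooth manifold with an atlas of coordinates $(x^i,y^a)$, $1\le i\le n$, $1\le a\le m$, an N-connection $N_i^a$ and a positive definite d-metric $g_{ij}\,e^ie^j+h_{ab}\,\mathbf e^a\mathbf e^b$, $e^i=dx^i$, $\mathbf e^a=dy^a+N_i^adx^i$, and with the canonical d-connection $\mathbf D=(L^i_{jk},L^a_{bk},C^i_{jc},C^a_{bc})$. Consider a smooth flow of curves $\gamma(\tau,l)\in V$, $\tau$ in an open set $I\subset\mathbb R$, $l\in\mathbb R$, with $X=\gamma_l$, $Y=\gamma_\tau$. An *h-flow with constant d-connection curvature $\overrightarrow R\in\mathbb R$* consists of $\gamma$ and a smooth orthonormal frame $e_1,\dots,e_n$ of h-vectors along $\gamma$ with $e_1=hX$ (so $|hX|=1$) and, for $2\le j\le n$, $$\mathbf D_Xe_1=\textstyle\sum_j v^je_j,\quad \mathbf D_Xe_j=-v^je_1,\quad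 \mathbf D_Ye_1=\sum_j\varpi^je_j,\quad \mathbf D_Ye_j=-\varpi^je_1+\sum_k\Theta_{jk}e_k,\quad hY=e_\parallel e_1+\sum_j e_\perp^je_j,$$ such that the h-part of the torsion vanishes on $(\gamma_\tau,\gamma_l)$ and the curvature of the flow has constant coefficients in the frame: $[\mathbf D_X,\mathbf D_Y]Z=\overrightarrow R\,\big(g(hX,Z)\,hY-g(hY,Z)\,hX\big)$ for h-vectors $Z$ (with this sign $\overrightarrow R$ is minus the sectional curvature). It is assumed that $\overrightarrow v=(v^j)$ and $h\overrightarrow e_\perp=(e_\perp^j)$ are rapidly decreasing in $l$ for each $\tau$, and that the integration constants of $e_\parallel$ and $\Theta$ (tangential speed and $l$-independent rotation of the frame) are normalized as in $D_X^{-1}$: $e_\parallel(\tau,l)+e_\parallel(\tau,-l)\to0$ and $\Theta(\tau,l)+\Theta(\tau,-l)\to0$ as $l\to\infty$. A *v-flow with constant curvature $\overleftarrow S$* is defined in the same way with $v$-vectors, $h_{ab}$ and $m$ in place of h-vectors, $g_{ij}$ and $n$. **Theorem.** 1. $\mathcal J$ and $\mathcal H$ are $(O(n-1),O(m-1))$-invariant: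 for $\rho$ in this group, $\mathcal J_{\rho v}(\rho X)=\rho\,\mathcal J_vX$ and $\mathcal H_{\rho v}(\rho\xi)=\rho\,\mathcal H_v\xi$. 2. $\mathcal J$ is a symplectic operator: $\mathcal J_v$ is linear and skew-adjoint, $v\mapsto\mathcal J_v$ is differentiable, and the two-form $\omega_v(X,Y)=\langle X,\mathcal J_vY\rangle$ is closed, i.e. $\langle X,\mathcal J'_v[Z]Y\rangle+\langle Y,\mathcal J'_v[X]Z\rangle+\langle Z,\mathcal J'_v[Y]X\rangle=0$ for all $v,X,Y,Z$. 3. $\mathcal H$ is a cosymplectic (Hamiltonian) operator: $\mathcal H_v$ is linear and skew-adjoint, $v\mapsto\mathcal H_v$ is differentiable, and the Jacobi identity $\langle\xi,\mathcal H'_v[\mathcal H_v\eta]\zeta\rangle+\langle\eta,\mathcal H'_v[\mathcal H_v\zeta]\xi\rangle+\langle\zeta,\mathcal H'_v[\mathcal H_v\xi]\eta\rangle=0$ holds for all $v$ and all $\xi,\eta,\zeta\in\mathrm{Dom}\,\mathcal H_v$. 4. The recursion operator $\Re=\mathcal H\circ\mathcal J$ is linear, differentiable in $v$, and hereditary: $\Re'_v[\Re_vX]Y-\Re'_v[\Re_vY]X=\Re_v\big(\Re'_v[X]Y-\Re'_v[Y]X\big)$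 for all $v$ and all $X,Y$ with $\mathcal J_vX,\mathcal J_vY\in\mathrm{Dom}\,\mathcal H_v$. 5. Every h-flow with constant d-connection curvature $\overrightarrow R$ has the Hamiltonian form $$\overrightarrow v_\tau=hH(\overrightarrow\varpi)-\overrightarrow R\,h\overrightarrow e_\perp=h\Re(h\overrightarrow e_\perp)-\overrightarrow R\,h\overrightarrow e_\perp,\qquad \overrightarrow\varpi=hJ(h\overrightarrow e_\perp),$$ and every v-flow with constant d-connection curvature $\overleftarrow S$ has the form $$\overleftarrow v_\tau=vH(\overleftarrow\varpi)-\overleftarrow S\,v\overleftarrow e_\perp=v\Re(v\overleftarrow e_\perp)-\overleftarrow S\,v\overleftarrow e_\perp,\qquad \overleftarrow\varpi=vJ(v\overleftarrow e_\perp).$$ -/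

import Mathlib

open scoped SchwartzMap ContDiff Manifold Topology

noncomputable section

/-! ### Rapidly decreasing functions of the arclength and the operators `D_X`, `D_X⁻¹` -/

/-- The space `ℝᵏ` of row vectors, with the Euclidean inner product. -/
abbrev Vec (k : ℕ) : Type := EuclideanSpace ℝ (Fin k)

/-- The phase space of one flow variable: rapidly decreasing functions of `l ∈ ℝ` with values
in `ℝᵏ`. -/
abbrev SField (k : ℕ) : Type := 𝓢(ℝ, Vec k)

section Antiderivative

variable {F : Type*} [NormedAddCommGroup F] [NormedSpace ℝ F]

/-- The (skew-adjoint) inverse of `D_X = ∂/∂l`: the antiderivative of `f` whose limits at `-∞` and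
at `+∞` add up to zero.  On the derivative of a rapidly decreasing function `h` it gives
back `h`. -/
def antideriv (f : 𝓢(ℝ, F)) (l : ℝ) : F :=
  (1 / 2 : ℝ) • ((∫ s in Set.Iic l, f s) - ∫ s in Set.Ioi l, f s)

variable [CompleteSpace F]

theorem hasDerivAt_antideriv (f : 𝓢(ℝ, F)) (l : ℝ) : HasDerivAt (antideriv f) (f l) l := by
  have hf : MeasureTheory.Integrable (fun s => f s) := f.integrable
  have key : antideriv f = fun x => (1 / 2 : ℝ) •
      ((∫ s in Set.Iic (0 : ℝ), f s) - (∫ s in Set.Ioi (0 : ℝ), f s)) + ∫ s in (0 : ℝ)..x, f s := by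
    funext x
    have h1 : (∫ s in (0 : ℝ)..x, f s) = (∫ s in Set.Iic x, f s) - ∫ s in Set.Iic (0 : ℝ), f s :=
      (intervalIntegral.integral_Iic_sub_Iic hf.integrableOn hf.integrableOn).symm
    have h2 : ∀ y : ℝ, (∫ s in Set.Ioi y, f s) = (∫ s, f s) - ∫ s in Set.Iic y, f s := by
      intro y
      rw [← intervalIntegral.integral_Iic_add_Ioi (b := y) hf.integrableOn hf.integrableOn]
      abel
    rw [antideriv, h1, h2 x, h2 0]
    module
  rw [key]
  have := intervalIntegral.integral_hasDerivAt_right (f := fun s => f s) (a := 0) (b := l)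
    hf.intervalIntegrable (f.continuous.stronglyMeasurableAtFilter _ _) f.continuous.continuousAt
  exact this.const_add _

theorem antideriv_hasTemperateGrowth (f : 𝓢(ℝ, F)) : (antideriv f).HasTemperateGrowth := by
  have hf : MeasureTheory.Integrable (fun s => f s) := f.integrable
  have hfd : fderiv ℝ (antideriv f)
      = fun x => ContinuousLinearMap.toSpanSingletonCLE (𝕜 := ℝ) (f x) := by
    funext x
    ext
    simp [(hasDerivAt_antideriv f x).hasFDerivAt.fderiv]
  refine Function.HasTemperateGrowth.of_fderiv (k := 0) (C := ∫ s, ‖f s‖) ?_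
    (fun x => (hasDerivAt_antideriv f x).differentiableAt) ?_
  · rw [hfd]
    exact (ContinuousLinearMap.toSpanSingletonCLE (𝕜 := ℝ)
      (E := F)).toContinuousLinearMap.hasTemperateGrowth.comp f.hasTemperateGrowth
  · intro x
    have h1 : ‖∫ s in Set.Iic x, f s‖ ≤ ∫ s, ‖f s‖ :=
      (MeasureTheory.norm_integral_le_integral_norm _).trans
        (MeasureTheory.setIntegral_le_integral hf.norm (by filter_upwards with s using norm_nonneg _))
    have h2 : ‖∫ s in Set.Ioi x, f s‖ ≤ ∫ s, ‖f s‖ :=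
      (MeasureTheory.norm_integral_le_integral_norm _).trans
        (MeasureTheory.setIntegral_le_integral hf.norm (by filter_upwards with s using norm_nonneg _))
    have h3 := norm_sub_le (∫ s in Set.Iic x, f s) (∫ s in Set.Ioi x, f s)
    rw [antideriv, norm_smul]
    norm_num
    linarith

end Antiderivative

/-! ### The symplectic, cosymplectic and recursion operators -/

/-- The pointwise inner product `v · X`. -/
def dotField {k : ℕ} (v X : SField k) : 𝓢(ℝ, ℝ) :=
  SchwartzMap.pairing (innerSL ℝ) v X

/-- The outer product `B ⊗ C = Bᵀ C` of row vectors, as the map `A ↦ A ⌋ (B ⊗ C) = (A · B) C`. -/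
def outerL (k : ℕ) : Vec k →L[ℝ] Vec k →L[ℝ] (Vec k →L[ℝ] Vec k) :=
  (ContinuousLinearMap.smulRightL ℝ (Vec k) (Vec k)).comp (innerSL ℝ)

/-- The skew product `v ∧ X = v ⊗ X - X ⊗ v`, pointwise. -/
def wedgeField {k : ℕ} (v X : SField k) : 𝓢(ℝ, Vec k →L[ℝ] Vec k) :=
  SchwartzMap.pairing (outerL k) v X - SchwartzMap.pairing (outerL k) X v

/-- `J_v X = D_X X + D_X⁻¹(v · X) v`. -/
def opJ {k : ℕ} (v X : SField k) : SField k :=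
  SchwartzMap.derivCLM ℝ (Vec k) X +
    SchwartzMap.bilinLeftCLM (ContinuousLinearMap.lsmul ℝ ℝ).flip
      (antideriv_hasTemperateGrowth (dotField v X)) v

/-- `H_v ξ = D_X ξ + v ⌋ D_X⁻¹(v ∧ ξ)`. -/
def opH {k : ℕ} (v ξ : SField k) : SField k :=
  SchwartzMap.derivCLM ℝ (Vec k) ξ +
    SchwartzMap.bilinLeftCLM (ContinuousLinearMap.id ℝ (Vec k →L[ℝ] Vec k)).flip
      (antideriv_hasTemperateGrowth (wedgeField v ξ)) v

/-- The recursion operator `H ∘ J`. -/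
def opR {k : ℕ} (v X : SField k) : SField k := opH v (opJ v X)

theorem opJ_apply {k : ℕ} (v X : SField k) (l : ℝ) :
    opJ v X l = deriv X l + antideriv (dotField v X) l • v l := rfl

theorem opH_apply {k : ℕ} (v ξ : SField k) (l : ℝ) :
    opH v ξ l = deriv ξ l + antideriv (wedgeField v ξ) l (v l) := rfl

theorem dotField_apply {k : ℕ} (v X : SField k) (l : ℝ) :
    dotField v X l = inner ℝ (v l) (X l) := rfl

theorem wedgeField_apply {k : ℕ} (v X : SField k) (l : ℝ) (A : Vec k) :
    wedgeField v X l A = inner ℝ (v l) A • X l - inner ℝ (X l) A • v l := rfl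

/-! ### Pairs of horizontal and vertical objects -/

/-- The phase space of the pair of flow variables `(v⃗, v⃖)`. -/
abbrev DField (p q : ℕ) : Type := SField p × SField q

/-- The d-operator `𝒥 = (h𝒥, v𝒥)`. -/
def dJ {p q : ℕ} (v X : DField p q) : DField p q := (opJ v.1 X.1, opJ v.2 X.2)

/-- The d-operator `ℋ = (hℋ, vℋ)`. -/
def dH {p q : ℕ} (v ξ : DField p q) : DField p q := (opH v.1 ξ.1, opH v.2 ξ.2)

/-- The d-operator `ℜ = (hℜ, vℜ)`. -/
def dR {p q : ℕ} (v X : DField p q) : DField p q := (opR v.1 X.1, opR v.2 X.2)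

/-- The pairing of d-covector fields and d-vector fields on the phase space. -/
def dPair {p q : ℕ} (ξ X : DField p q) : ℝ :=
  (∫ l, inner ℝ (ξ.1 l) (X.1 l)) + ∫ l, inner ℝ (ξ.2 l) (X.2 l)

/-- The action of a pair of orthogonal transformations. -/
def dAct {p q : ℕ} (A : Vec p ≃ₗᵢ[ℝ] Vec p) (B : Vec q ≃ₗᵢ[ℝ] Vec q) (X : DField p q) :
    DField p q :=
  (SchwartzMap.postcompCLM A.toContinuousLinearEquiv.toContinuousLinearMap X.1,
    SchwartzMap.postcompCLM B.toContinuousLinearEquiv.toContinuousLinearMap X.2)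

/-- The natural domain of `ℋ` at `v`: the covectors `ξ` for which `v ∧ ξ` (in both components) is
the derivative of a rapidly decreasing function, so that the nonlocal term `D_X⁻¹(v ∧ ξ)` is rapidly
decreasing.  A differentiable functional has its gradient there at every `v` if and only if it is
invariant under rotations. -/
def dDomH {p q : ℕ} (v : DField p q) : Set (DField p q) :=
  {ξ | (∫ l, wedgeField v.1 ξ.1 l) = 0 ∧ (∫ l, wedgeField v.2 ξ.2 l) = 0}

/-! ### Hamiltonian operators on a phase space -/

section Hamiltonian

variable {E : Type*} [AddCommGroup E] [Module ℝ E] [TopologicalSpace E]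

/-- `Z` is the derivative at `v` of the map `A` in the direction `W`. -/
def HasDirDeriv (A : E → E) (v W Z : E) : Prop :=
  Filter.Tendsto (fun t : ℝ => t⁻¹ • (A (v + t • W) - A v)) (𝓝[≠] 0) (𝓝 Z)

/-- `dA v W X` is the derivative in the direction `W` of `v ↦ A_v X` with `X` fixed. -/
def IsOperatorDeriv (A : E → E → E) (dA : E → E → E → E) : Prop :=
  ∀ v W X : E, HasDirDeriv (fun u => A u X) v W (dA v W X)

/-- `J` is a symplectic operator: `ω_v(X, Y) = ⟨X, J_v Y⟩` is a closed two-form on the phase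
space. -/
def IsSymplecticOperator (pair : E → E → ℝ) (J : E → E → E) : Prop :=
  (∀ v, IsLinearMap ℝ (J v)) ∧
  (∀ v X Y, pair X (J v Y) = - pair Y (J v X)) ∧
  ∃ J' : E → E → E → E, IsOperatorDeriv J J' ∧
    ∀ v X Y Z, pair X (J' v Z Y) + pair Y (J' v X Z) + pair Z (J' v Y X) = 0

/-- `H` is a cosymplectic (Hamiltonian) operator on the covectors of the domain `dom`: the
bracket `{F, G}(v) = ⟨δF/δv, H_v (δG/δv)⟩` is skew, and it obeys the Jacobi identity, that is, the
Schouten bracket of the bivector of `H` with itself vanishes. -/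
def IsCosymplecticOperator (pair : E → E → ℝ) (dom : E → Set E) (H : E → E → E) : Prop :=
  (∀ v, IsLinearMap ℝ (H v)) ∧
  (∀ v ξ η, pair ξ (H v η) = - pair η (H v ξ)) ∧
  ∃ H' : E → E → E → E, IsOperatorDeriv H H' ∧
    ∀ v, ∀ ξ ∈ dom v, ∀ η ∈ dom v, ∀ ζ ∈ dom v,
      pair ξ (H' v (H v η) ζ) + pair η (H' v (H v ζ) ξ) + pair ζ (H' v (H v ξ) η) = 0

/-- `R` is a hereditary operator on the vectors of the domain `dom`: its Nijenhuis torsion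
vanishes. -/
def IsHereditaryOperator (dom : E → Set E) (R : E → E → E) : Prop :=
  (∀ v, IsLinearMap ℝ (R v)) ∧
  ∃ R' : E → E → E → E, IsOperatorDeriv R R' ∧
    ∀ v, ∀ X ∈ dom v, ∀ Y ∈ dom v,
      R' v (R v X) Y - R' v (R v Y) X = R v (R' v X Y - R' v Y X)

end Hamiltonian

/-! ### N-anholonomic manifolds and the canonical d-connection -/

/-- Local coordinates `u = (x, y)`. -/
abbrev Coord (n m : ℕ) : Type := (Fin n → ℝ) × (Fin m → ℝ)

/-- Local charts of a manifold with coordinates `(x, y)`. -/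
abbrev LChart (n m : ℕ) (V : Type*) [TopologicalSpace V] : Type _ :=
  OpenPartialHomeomorph V (Coord n m)

/-- An N-connection and a d-metric on a manifold `V`, in the coordinates of the charts of its
atlas: the coefficients `N a i = N_i^a`, `g i j` and `h a b`.  The forms `g_{ij} e^i e^j` and
`h_{ab} 𝐞^a 𝐞^b`, where `e^i = dx^i` and `𝐞^a = dy^a + N_i^a dx^i`, do not depend on the chart; so
the vertical distribution `e^i = 0`, the horizontal distribution `𝐞^a = 0` and the d-metric are
globally defined. -/
structure NAnholonomic (n m : ℕ) (V : Type*) [TopologicalSpace V] [ChartedSpace (Coord n m) V] where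
  N : LChart n m V → Coord n m → Matrix (Fin m) (Fin n) ℝ
  g : LChart n m V → Coord n m → Matrix (Fin n) (Fin n) ℝ
  h : LChart n m V → Coord n m → Matrix (Fin m) (Fin m) ℝ
  smooth_N : ∀ φ ∈ atlas (Coord n m) V, ∀ a i, ContDiffOn ℝ ∞ (fun u => N φ u a i) φ.target
  smooth_g : ∀ φ ∈ atlas (Coord n m) V, ∀ i j, ContDiffOn ℝ ∞ (fun u => g φ u i j) φ.target
  smooth_h : ∀ φ ∈ atlas (Coord n m) V, ∀ a b, ContDiffOn ℝ ∞ (fun u => h φ u a b) φ.target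
  posDef_g : ∀ φ ∈ atlas (Coord n m) V, ∀ u ∈ φ.target, (g φ u).PosDef
  posDef_h : ∀ φ ∈ atlas (Coord n m) V, ∀ u ∈ φ.target, (h φ u).PosDef
  invariant_g : ∀ φ ∈ atlas (Coord n m) V, ∀ ψ ∈ atlas (Coord n m) V,
    ∀ u ∈ (φ.symm.trans ψ).source, ∀ ξ : Coord n m,
      let ξ' := fderiv ℝ (φ.symm.trans ψ) u ξ
      ξ'.1 ⬝ᵥ (g ψ (φ.symm.trans ψ u)).mulVec ξ'.1 = ξ.1 ⬝ᵥ (g φ u).mulVec ξ.1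
  invariant_h : ∀ φ ∈ atlas (Coord n m) V, ∀ ψ ∈ atlas (Coord n m) V,
    ∀ u ∈ (φ.symm.trans ψ).source, ∀ ξ : Coord n m,
      let ξ' := fderiv ℝ (φ.symm.trans ψ) u ξ
      let e := ξ.2 + (N φ u).mulVec ξ.1
      let e' := ξ'.2 + (N ψ (φ.symm.trans ψ u)).mulVec ξ'.1
      e' ⬝ᵥ (h ψ (φ.symm.trans ψ u)).mulVec e' = e ⬝ᵥ (h φ u).mulVec e

section Connection

variable {n m : ℕ}

/-- The N-elongated derivative `𝐞_k f = ∂f/∂x^k - N_k^a ∂f/∂y^a`. -/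
def eH (N : Coord n m → Matrix (Fin m) (Fin n) ℝ) (k : Fin n) (f : Coord n m → ℝ)
    (u : Coord n m) : ℝ :=
  fderiv ℝ f u (Pi.single k 1, fun a => - N u a k)

/-- The vertical derivative `e_c f = ∂f/∂y^c`. -/
def eV (c : Fin m) (f : Coord n m → ℝ) (u : Coord n m) : ℝ :=
  fderiv ℝ f u (0, Pi.single c 1)

variable (N : Coord n m → Matrix (Fin m) (Fin n) ℝ) (g : Coord n m → Matrix (Fin n) (Fin n) ℝ)
  (h : Coord n m → Matrix (Fin m) (Fin m) ℝ)

/-- The coefficient `L^i_{jk}` of the canonical d-connection. -/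
def coefL (u : Coord n m) (i j k : Fin n) : ℝ :=
  (1 / 2) * ∑ r, (g u)⁻¹ i r * (eH N k (fun w => g w j r) u + eH N j (fun w => g w k r) u
    - eH N r (fun w => g w j k) u)

/-- The coefficient `L^a_{bk}` of the canonical d-connection. -/
def coefLv (u : Coord n m) (a b : Fin m) (k : Fin n) : ℝ :=
  eV b (fun w => N w a k) u +
    (1 / 2) * ∑ c, (h u)⁻¹ a c * (eH N k (fun w => h w b c) u
      - (∑ d, h u d c * eV b (fun w => N w d k) u) - ∑ d, h u d b * eV c (fun w => N w d k) u)

/-- The coefficient `C^i_{jc}` of the canonical d-connection. -/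
def coefCh (u : Coord n m) (i j : Fin n) (c : Fin m) : ℝ :=
  (1 / 2) * ∑ k, (g u)⁻¹ i k * eV c (fun w => g w j k) u

/-- The coefficient `C^a_{bc}` of the canonical d-connection. -/
def coefC (u : Coord n m) (a b c : Fin m) : ℝ :=
  (1 / 2) * ∑ d, (h u)⁻¹ a d * (eV c (fun w => h w b d) u + eV b (fun w => h w c d) u
    - eV d (fun w => h w b c) u)

end Connection

/-- One of the two blocks (horizontal or vertical) of an N-adapted geometry in a chart: the coframe
`θ`, the connection 1-form `conn` and the metric.  The second argument of `θ` and `conn` is the tangent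
vector, in coordinates. -/
structure DBlock (n m k : ℕ) where
  θ : Coord n m → Coord n m → Fin k → ℝ
  conn : Coord n m → Coord n m → Matrix (Fin k) (Fin k) ℝ
  met : Coord n m → Matrix (Fin k) (Fin k) ℝ

/-- The horizontal block: the coframe `e^i = dx^i`, the connection 1-form
`L^i_{jk} e^k + C^i_{jc} 𝐞^c` and the metric `g`. -/
def NAnholonomic.hBlock {n m : ℕ} {V : Type*} [TopologicalSpace V] [ChartedSpace (Coord n m) V]
    (S : NAnholonomic n m V) (φ : LChart n m V) : DBlock n m n where
  θ _ ξ := ξ.1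
  conn u ξ := Matrix.of fun i j => (∑ k, coefL (S.N φ) (S.g φ) u i j k * ξ.1 k)
    + ∑ c, coefCh (S.g φ) u i j c * (ξ.2 + (S.N φ u).mulVec ξ.1) c
  met := S.g φ

/-- The vertical block: the coframe `𝐞^a = dy^a + N_i^a dx^i`, the connection 1-form
`L^a_{bk} e^k + C^a_{bc} 𝐞^c` and the metric `h`. -/
def NAnholonomic.vBlock {n m : ℕ} {V : Type*} [TopologicalSpace V] [ChartedSpace (Coord n m) V]
    (S : NAnholonomic n m V) (φ : LChart n m V) : DBlock n m m where
  θ u ξ := ξ.2 + (S.N φ u).mulVec ξ.1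
  conn u ξ := Matrix.of fun a b => (∑ k, coefLv (S.N φ) (S.h φ) u a b k * ξ.1 k)
    + ∑ c, coefC (S.h φ) u a b c * (ξ.2 + (S.N φ u).mulVec ξ.1) c
  met := S.h φ

namespace DBlock

variable {n m k : ℕ} (B : DBlock n m k)

/-- The inner product of two h-vectors (v-vectors). -/
def ip (u : Coord n m) (a b : Fin k → ℝ) : ℝ := a ⬝ᵥ (B.met u).mulVec b

/-- The torsion 2-form `dθ + conn ∧ θ`. -/
def torsion (u ξ η : Coord n m) : Fin k → ℝ := fun i =>
  fderiv ℝ (fun w => B.θ w η i) u ξ - fderiv ℝ (fun w => B.θ w ξ i) u η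
    + (B.conn u ξ).mulVec (B.θ u η) i - (B.conn u η).mulVec (B.θ u ξ) i

/-- The curvature 2-form `d conn + conn ∧ conn`; `curvature u ξ η` is the operator `[D_ξ, D_η]`. -/
def curvature (u ξ η : Coord n m) : Matrix (Fin k) (Fin k) ℝ := Matrix.of fun i j =>
  fderiv ℝ (fun w => B.conn w η i j) u ξ - fderiv ℝ (fun w => B.conn w ξ i j) u η
    + (B.conn u ξ * B.conn u η - B.conn u η * B.conn u ξ) i j

end DBlock

/-! ### Curve flows -/

section Flow

variable {n m : ℕ} {V : Type*} [TopologicalSpace V]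

/-- The tangent vector `X = γ_l` in the chart `φ`. -/
def velL (φ : LChart n m V) (γ : ℝ → ℝ → V) (τ l : ℝ) : Coord n m :=
  deriv (fun s => φ (γ τ s)) l

/-- The flow vector `Y = γ_τ` in the chart `φ`. -/
def velT (φ : LChart n m V) (γ : ℝ → ℝ → V) (τ l : ℝ) : Coord n m :=
  deriv (fun s => φ (γ s l)) τ

/-- The covariant derivative `D_X Z` along `γ`. -/
def covL {k : ℕ} (B : DBlock n m k) (φ : LChart n m V) (γ : ℝ → ℝ → V)
    (Z : ℝ → ℝ → Fin k → ℝ) (τ l : ℝ) : Fin k → ℝ :=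
  deriv (fun s => Z τ s) l + (B.conn (φ (γ τ l)) (velL φ γ τ l)).mulVec (Z τ l)

/-- The covariant derivative `D_Y Z` along `γ`. -/
def covT {k : ℕ} (B : DBlock n m k) (φ : LChart n m V) (γ : ℝ → ℝ → V)
    (Z : ℝ → ℝ → Fin k → ℝ) (τ l : ℝ) : Fin k → ℝ :=
  deriv (fun s => Z s l) τ + (B.conn (φ (γ τ l)) (velT φ γ τ l)).mulVec (Z τ l)

variable [ChartedSpace (Coord n m) V]

/-- A moving frame `e_0, …, e_r` of h-vectors (v-vectors) along `γ`, given in each chart by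
components that depend smoothly on `(τ, l)`, change with the chart as vectors do, and are
orthonormal. -/
structure IsMovingFrame {r : ℕ} (B : LChart n m V → DBlock n m (r + 1)) (I : Set ℝ)
    (γ : ℝ → ℝ → V) (e : LChart n m V → Fin (r + 1) → ℝ → ℝ → Fin (r + 1) → ℝ) : Prop where
  smooth : ∀ φ ∈ atlas (Coord n m) V, ∀ i,
    ContDiffOn ℝ ∞ (fun z : ℝ × ℝ => e φ i z.1 z.2) {z | z.1 ∈ I ∧ γ z.1 z.2 ∈ φ.source}
  change : ∀ φ ∈ atlas (Coord n m) V, ∀ ψ ∈ atlas (Coord n m) V, ∀ i, ∀ τ ∈ I, ∀ l,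
    γ τ l ∈ φ.source → γ τ l ∈ ψ.source → ∀ ξ : Coord n m,
      (B φ).θ (φ (γ τ l)) ξ = e φ i τ l →
        (B ψ).θ (ψ (γ τ l)) (fderiv ℝ (φ.symm.trans ψ) (φ (γ τ l)) ξ) = e ψ i τ l
  orthonormal : ∀ φ ∈ atlas (Coord n m) V, ∀ τ ∈ I, ∀ l, γ τ l ∈ φ.source → ∀ i j,
    (B φ).ip (φ (γ τ l)) (e φ i τ l) (e φ j τ l) = if i = j then 1 else 0

/-- The curve flow `γ(τ, l)`, `τ ∈ I`, `l ∈ ℝ`, of non-stretching curves, in one of the two blocks,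
framed by a parallel moving frame `e` with `e_0` the unit tangent h-vector (v-vector)
of the curve.

* `v` is the principal normal in the tangent direction, `ϖ` and `Θ` are the components of the
  connection in the flow direction, `par` and `perp` the tangential and normal components of the flow
  vector.
* The torsion and the curvature of the flow, `𝐓(γ_τ, γ_l)` and `𝐑(γ_τ, γ_l) = [D_X, D_Y]`, are
  those of a space of constant curvature: the former vanishes, the latter has constant coefficients
  `R (δ δ - δ δ)` in an orthonormal frame.  With this sign convention `R` is minus the sectional
  curvature.
* The tangential speed and the rotation of the frame, which the curve in `V` determines only
  up to functions of `τ`, are normalized in the same way as `D_X⁻¹`. -/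
structure IsCurveFlow {r : ℕ} (B : LChart n m V → DBlock n m (r + 1)) (R : ℝ) (I : Set ℝ)
    (γ : ℝ → ℝ → V) (e : LChart n m V → Fin (r + 1) → ℝ → ℝ → Fin (r + 1) → ℝ)
    (v perp : ℝ → SField r) (ϖ : ℝ → ℝ → Vec r) (par : ℝ → ℝ → ℝ)
    (Θ : ℝ → ℝ → Matrix (Fin r) (Fin r) ℝ) : Prop where
  isOpen : IsOpen I
  smooth : ContMDiffOn 𝓘(ℝ, ℝ × ℝ) 𝓘(ℝ, Coord n m) ∞ (fun z : ℝ × ℝ => γ z.1 z.2)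
    (I ×ˢ Set.univ)
  frame : IsMovingFrame B I γ e
  tangent : ∀ φ ∈ atlas (Coord n m) V, ∀ τ ∈ I, ∀ l, γ τ l ∈ φ.source →
    (B φ).θ (φ (γ τ l)) (velL φ γ τ l) = e φ 0 τ l
  flow : ∀ φ ∈ atlas (Coord n m) V, ∀ τ ∈ I, ∀ l, γ τ l ∈ φ.source →
    (B φ).θ (φ (γ τ l)) (velT φ γ τ l) = par τ l • e φ 0 τ l + ∑ j, perp τ l j • e φ j.succ τ l
  covL_zero : ∀ φ ∈ atlas (Coord n m) V, ∀ τ ∈ I, ∀ l, γ τ l ∈ φ.source →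
    covL (B φ) φ γ (e φ 0) τ l = ∑ j, v τ l j • e φ j.succ τ l
  covL_succ : ∀ φ ∈ atlas (Coord n m) V, ∀ τ ∈ I, ∀ l, γ τ l ∈ φ.source → ∀ j : Fin r,
    covL (B φ) φ γ (e φ j.succ) τ l = - v τ l j • e φ 0 τ l
  covT_zero : ∀ φ ∈ atlas (Coord n m) V, ∀ τ ∈ I, ∀ l, γ τ l ∈ φ.source →
    covT (B φ) φ γ (e φ 0) τ l = ∑ j, ϖ τ l j • e φ j.succ τ l
  covT_succ : ∀ φ ∈ atlas (Coord n m) V, ∀ τ ∈ I, ∀ l, γ τ l ∈ φ.source → ∀ j : Fin r,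
    covT (B φ) φ γ (e φ j.succ) τ l = - ϖ τ l j • e φ 0 τ l + ∑ i, Θ τ l j i • e φ i.succ τ l
  torsion_eq : ∀ φ ∈ atlas (Coord n m) V, ∀ τ ∈ I, ∀ l, γ τ l ∈ φ.source →
    (B φ).torsion (φ (γ τ l)) (velT φ γ τ l) (velL φ γ τ l) = 0
  curvature_eq : ∀ φ ∈ atlas (Coord n m) V, ∀ τ ∈ I, ∀ l, γ τ l ∈ φ.source → ∀ Z,
    let u := φ (γ τ l)
    let X := (B φ).θ u (velL φ γ τ l)
    let Y := (B φ).θ u (velT φ γ τ l)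
    ((B φ).curvature u (velL φ γ τ l) (velT φ γ τ l)).mulVec Z =
      R • ((B φ).ip u X Z • Y - (B φ).ip u Y Z • X)
  normalized_par : ∀ τ ∈ I, Filter.Tendsto (fun l => par τ l + par τ (-l)) Filter.atTop (𝓝 0)
  normalized_rot : ∀ τ ∈ I, ∀ i j,
    Filter.Tendsto (fun l => Θ τ l i j + Θ τ (-l) i j) Filter.atTop (𝓝 0)

end Flow

/-- The flow equations in Hamiltonian form, `v_τ = H(ϖ) - R e_⊥ = ℜ(e_⊥) - R e_⊥` with
`ϖ = J(e_⊥)`; in particular `ϖ` is rapidly decreasing. -/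
def HamiltonianFlow {r : ℕ} (R : ℝ) (I : Set ℝ) (v perp : ℝ → SField r)
    (ϖ : ℝ → ℝ → Vec r) : Prop :=
  ∃ w : ℝ → SField r, ∀ τ ∈ I,
    (∀ l, ϖ τ l = w τ l) ∧ w τ = opJ (v τ) (perp τ) ∧
    (∀ l, HasDerivAt (fun s => v s l) ((opH (v τ) (w τ) - R • perp τ) l) τ) ∧
    (∀ l, HasDerivAt (fun s => v s l) ((opR (v τ) (perp τ) - R • perp τ) l) τ)

end

/-! All nonlocality sits in `D_X⁻¹`, and two of its properties carry the proof. Its limits at `±∞`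
are `±½∫f`, so the boundary terms of an integration by parts cancel and it is skew-adjoint
(`integral_bilin_antideriv`). It is also the only primitive `Φ` with `Φ(l) + Φ(-l) → 0`
(`antideriv_eq_of_hasDerivAt`), so an identity between nonlocal expressions reduces to a comparison
of derivatives and a check at infinity.

Skew-adjointness of `J` and `H` and closedness of the two-form of `J` follow from the first
property; for `H`, pairings with a skew endomorphism are first rewritten through the trace form
`tr(MP)`. All three operators are polynomial in `v`, so their derivatives are read off from
expansions in `t`. For the Jacobi identity put `Ξ, N, Z = D_X⁻¹(v ∧ ξ), D_X⁻¹(v ∧ η), D_X⁻¹(v ∧ ζ)`.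
The density is the derivative of `⟨η, Ξζ⟩ + ⟨ζ, Nξ⟩ + ⟨ξ, Zη⟩ + tr(ΞNZ)`, which vanishes at both
ends on the domain of `H` (`l2_derivH_cyclic`).

Heredity is verified directly. With `A = D_X⁻¹(v ∧ JX)`, `B = D_X⁻¹(v ∧ JY)` and `T = ℜ'[X]Y -
ℜ'[Y]X`, one finds `JT = J'[ℜX]Y - J'[ℜY]X + B(JX) - A(JY)`, while `D_X⁻¹(v ∧ JT)` contains the
commutator `BA - AB`; inserting both into `ℜT` gives `derivR_torsion`.

The flow equations are Cartan's structure equations, pulled back to the `(τ, l)`-plane and written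
in the moving frame. Torsion gives `D_X e_∥ = v · e_⊥` and `ϖ = D_X e_⊥ + e_∥ v`; curvature gives
the `l`-derivative of `Θ` and `v_τ = D_X ϖ - vΘ - R e_⊥`. The normalizations at infinity force `e_∥
= D_X⁻¹(v · e_⊥)` and identify `-Θ` with `D_X⁻¹(v ∧ ϖ)`, which produces `J` and `H`. The canonical
d-connection enters through its smoothness and its linearity in the tangent vector. -/

open MeasureTheory Filter

/-! ### The antiderivative -/

section AntiderivativeLemmas

variable {F G K : Type*} [NormedAddCommGroup F] [NormedSpace ℝ F]
  [NormedAddCommGroup G] [NormedSpace ℝ G] [NormedAddCommGroup K] [NormedSpace ℝ K]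

theorem antideriv_add (f g : 𝓢(ℝ, F)) (l : ℝ) :
    antideriv (f + g) l = antideriv f l + antideriv g l := by
  have hf : Integrable (fun s => f s) := f.integrable
  have hg : Integrable (fun s => g s) := g.integrable
  simp only [antideriv, add_apply]
  rw [integral_add hf.integrableOn hg.integrableOn, integral_add hf.integrableOn hg.integrableOn]
  module

theorem antideriv_smul (c : ℝ) (f : 𝓢(ℝ, F)) (l : ℝ) :
    antideriv (c • f) l = c • antideriv f l := by
  simp only [antideriv, smul_apply]
  rw [integral_smul, integral_smul]
  module

theorem antideriv_neg (f : 𝓢(ℝ, F)) (l : ℝ) : antideriv (-f) l = -antideriv f l := by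
  simpa using antideriv_smul (-1) f l

theorem antideriv_sub (f g : 𝓢(ℝ, F)) (l : ℝ) :
    antideriv (f - g) l = antideriv f l - antideriv g l := by
  rw [sub_eq_add_neg, antideriv_add, antideriv_neg, sub_eq_add_neg]

theorem antideriv_zero (l : ℝ) : antideriv (0 : 𝓢(ℝ, F)) l = 0 := by
  simp [antideriv]

/-- Linear conditions on an operator-valued field pass to its antiderivative this way:
skew-symmetry, equivariance under rotations, and matrix entries. -/
theorem ContinuousLinearMap.antideriv_postcomp [CompleteSpace F] [CompleteSpace G] (L : F →L[ℝ] G)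
    (f : 𝓢(ℝ, F)) (l : ℝ) : antideriv (f.postcompCLM L) l = L (antideriv f l) := by
  have hf : Integrable (fun s => f s) := f.integrable
  simp only [antideriv, SchwartzMap.postcompCLM_apply, map_smul, map_sub]
  rw [L.integral_comp_comm hf.integrableOn, L.integral_comp_comm hf.integrableOn]

theorem SchwartzMap.tendsto_atTop (f : 𝓢(ℝ, F)) : Tendsto f atTop (𝓝 0) :=
  f.tendsto_cocompact.mono_left atTop_le_cocompact

theorem SchwartzMap.tendsto_atBot (f : 𝓢(ℝ, F)) : Tendsto f atBot (𝓝 0) :=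
  f.tendsto_cocompact.mono_left atBot_le_cocompact

theorem SchwartzMap.tendsto_add_neg (f : 𝓢(ℝ, F)) :
    Tendsto (fun l => f l + f (-l)) atTop (𝓝 0) := by
  simpa using f.tendsto_atTop.add (f.tendsto_atBot.comp tendsto_neg_atTop_atBot)

variable [CompleteSpace F] [CompleteSpace G] [CompleteSpace K]

/-- With its counterpart at `-∞` this shows that the two limits are opposite, and that both vanish
when the total integral is zero, which is the condition defining the domain of `H`. -/
theorem tendsto_antideriv_atTop (f : 𝓢(ℝ, F)) :
    Tendsto (antideriv f) atTop (𝓝 ((1 / 2 : ℝ) • ∫ s, f s)) := by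
  have hf : Integrable (fun s => f s) := f.integrable
  have key : antideriv f = fun x => antideriv f 0 + ∫ s in (0 : ℝ)..x, f s := by
    funext x
    rw [intervalIntegral.integral_eq_sub_of_hasDerivAt (fun y _ => hasDerivAt_antideriv f y)
      hf.intervalIntegrable]
    abel
  have h := (intervalIntegral_tendsto_integral_Ioi (0 : ℝ) hf.integrableOn tendsto_id).const_add
    (antideriv f 0)
  rw [key]
  simp only [id] at h
  convert h using 2
  rw [← intervalIntegral.integral_Iic_add_Ioi (b := (0 : ℝ)) hf.integrableOn hf.integrableOn,
    antideriv]
  module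

theorem tendsto_antideriv_atBot (f : 𝓢(ℝ, F)) :
    Tendsto (antideriv f) atBot (𝓝 (-((1 / 2 : ℝ) • ∫ s, f s))) := by
  have hf : Integrable (fun s => f s) := f.integrable
  have key : antideriv f = fun x => antideriv f 0 - ∫ s in x..(0 : ℝ), f s := by
    funext x
    rw [intervalIntegral.integral_eq_sub_of_hasDerivAt (fun y _ => hasDerivAt_antideriv f y)
      hf.intervalIntegrable]
    abel
  have h := (intervalIntegral_tendsto_integral_Iic (0 : ℝ) hf.integrableOn tendsto_id).const_sub
    (antideriv f 0)
  rw [key]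
  simp only [id] at h
  convert h using 2
  rw [← intervalIntegral.integral_Iic_add_Ioi (b := (0 : ℝ)) hf.integrableOn hf.integrableOn,
    antideriv]
  module

theorem tendsto_antideriv_add_antideriv_neg (f : 𝓢(ℝ, F)) :
    Tendsto (fun l => antideriv f l + antideriv f (-l)) atTop (𝓝 0) := by
  have h := (tendsto_antideriv_atTop f).add
    ((tendsto_antideriv_atBot f).comp tendsto_neg_atTop_atBot)
  simpa using h

/-- The antiderivative is characterized by its derivative and its normalization at infinity. -/
theorem antideriv_eq_of_hasDerivAt {f : 𝓢(ℝ, F)} {Φ : ℝ → F} (h : ∀ l, HasDerivAt Φ (f l) l)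
    (h0 : Tendsto (fun l => Φ l + Φ (-l)) atTop (𝓝 0)) (l : ℝ) : antideriv f l = Φ l := by
  have hd : ∀ x, HasDerivAt (fun y => Φ y - antideriv f y) 0 x := fun x => by
    have := (h x).fun_sub (hasDerivAt_antideriv f x)
    rwa [sub_self] at this
  -- Two primitives differ by a constant; the normalization at `±∞`, shared by both, makes twice
  -- that constant zero.
  have hc : ∀ x, Φ x - antideriv f x = Φ l - antideriv f l := fun x =>
    is_const_of_deriv_eq_zero (fun y => (hd y).differentiableAt) (fun y => (hd y).deriv) x l
  have h1 := h0.sub (tendsto_antideriv_add_antideriv_neg f)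
  have h2 : (fun x => Φ x + Φ (-x) - (antideriv f x + antideriv f (-x)))
      = fun _ => (2 : ℝ) • (Φ l - antideriv f l) := by
    funext x
    rw [two_smul]
    nth_rewrite 1 [← hc x]
    rw [← hc (-x)]
    abel
  rw [h2, sub_zero] at h1
  have h3 := tendsto_nhds_unique h1 tendsto_const_nhds
  rw [eq_comm, smul_eq_zero_iff_right two_ne_zero, sub_eq_zero] at h3
  exact h3.symm

/-- The antiderivative is skew-adjoint. -/
theorem integral_bilin_antideriv (L : F →L[ℝ] G →L[ℝ] K) (f : 𝓢(ℝ, F)) (g : 𝓢(ℝ, G)) :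
    ∫ l, L (antideriv f l) (g l) = -∫ l, L (f l) (antideriv g l) := by
  have h1 : Integrable fun l => L (antideriv f l) (g l) :=
    (SchwartzMap.bilinLeftCLM L.flip (antideriv_hasTemperateGrowth f) g).integrable
  have h2 : Integrable fun l => L (f l) (antideriv g l) :=
    (SchwartzMap.bilinLeftCLM L (antideriv_hasTemperateGrowth g) f).integrable
  have hd : ∀ l, HasDerivAt (fun l => L (antideriv f l) (antideriv g l))
      (L (antideriv f l) (g l) + L (f l) (antideriv g l)) l := fun l =>
    by
    exact L.hasDerivAt_of_bilinear (fun _ => hasDerivAt_antideriv f l)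
      (fun _ => hasDerivAt_antideriv g l)
  have hL : Continuous fun p : F × G => L p.1 p.2 := by fun_prop
  have ht := (hL.tendsto _).comp
    ((tendsto_antideriv_atTop f).prodMk_nhds (tendsto_antideriv_atTop g))
  have hb := (hL.tendsto _).comp
    ((tendsto_antideriv_atBot f).prodMk_nhds (tendsto_antideriv_atBot g))
  -- Both factors change sign between the two ends, so their product has the same limit `L (½∫f)
  -- (½∫g)` at `-∞` and at `+∞`.
  have h3 := integral_of_hasDerivAt_of_tendsto hd (h1.add h2) hb ht
  rw [integral_add h1 h2] at h3
  rw [eq_neg_iff_add_eq_zero, h3]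
  simp

end AntiderivativeLemmas

/-! ### Pointwise linear algebra of the skew product -/

section Wedge

variable {k : ℕ}

/-- The skew product `a ∧ b` of two row vectors. -/
noncomputable def wedge (a b : Vec k) : Vec k →L[ℝ] Vec k := outerL k a b - outerL k b a

theorem wedge_apply (a b x : Vec k) :
    wedge a b x = inner ℝ a x • b - inner ℝ b x • a := rfl

theorem wedgeField_eq (v X : SField k) (l : ℝ) : wedgeField v X l = wedge (v l) (X l) := rfl

theorem inner_wedge_apply (a b x y : Vec k) :
    inner ℝ (wedge a b x) y = inner ℝ a x * inner ℝ b y - inner ℝ b x * inner ℝ a y := by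
  rw [wedge_apply, inner_sub_left, real_inner_smul_left, real_inner_smul_left]

theorem inner_apply_wedge (a b x y : Vec k) :
    inner ℝ y (wedge a b x) = inner ℝ a x * inner ℝ b y - inner ℝ b x * inner ℝ a y := by
  rw [real_inner_comm, inner_wedge_apply]

/-- Skew-symmetric endomorphisms. -/
def IsSkewEnd (M : Vec k →L[ℝ] Vec k) : Prop := ∀ x y, inner ℝ (M x) y = -inner ℝ x (M y)

theorem isSkewEnd_wedge (a b : Vec k) : IsSkewEnd (wedge a b) := fun x y => by
  rw [inner_wedge_apply, inner_apply_wedge]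
  ring

/-- For fixed `x` and `y`, skewness is the vanishing of a continuous linear functional of the
endomorphism, so it is inherited from the pointwise values `v ∧ X`. -/
theorem isSkewEnd_antideriv_wedgeField (v X : SField k) (l : ℝ) :
    IsSkewEnd (antideriv (wedgeField v X) l) := fun x y => by
  let L : (Vec k →L[ℝ] Vec k) →L[ℝ] ℝ :=
    (innerSL ℝ y).comp (ContinuousLinearMap.apply ℝ (Vec k) x)
      + (innerSL ℝ x).comp (ContinuousLinearMap.apply ℝ (Vec k) y)
  have hL : ∀ M, L M = inner ℝ y (M x) + inner ℝ x (M y) := fun M => rfl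
  have h0 : (wedgeField v X).postcompCLM L = 0 := by
    ext s
    have := isSkewEnd_wedge (v s) (X s) x y
    rw [real_inner_comm] at this
    simp only [SchwartzMap.postcompCLM_apply, hL, wedgeField_eq, this]
    simp
  have h1 := L.antideriv_postcomp (wedgeField v X) l
  rw [h0, antideriv_zero, hL] at h1
  rw [real_inner_comm]
  linarith

/-- The trace of endomorphisms, as a continuous functional. -/
noncomputable def traceL (k : ℕ) : (Vec k →L[ℝ] Vec k) →L[ℝ] ℝ :=
  LinearMap.toContinuousLinearMap
    ((LinearMap.trace ℝ (Vec k)).comp (ContinuousLinearMap.coeLM ℝ))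

theorem traceL_comp_comm (M P : Vec k →L[ℝ] Vec k) : traceL k (M.comp P) = traceL k (P.comp M) :=
  LinearMap.trace_mul_comm ℝ (M : Vec k →ₗ[ℝ] Vec k) (P : Vec k →ₗ[ℝ] Vec k)

/-- The composite is the rank-one map `x ↦ ⟨a, x⟩ M b`. -/
theorem traceL_comp_outerL (M : Vec k →L[ℝ] Vec k) (a b : Vec k) :
    traceL k (M.comp (outerL k a b)) = inner ℝ a (M b) := by
  have h : ((M.comp (outerL k a b) : Vec k →L[ℝ] Vec k) : Vec k →ₗ[ℝ] Vec k)
      = (innerₛₗ ℝ a).smulRight (M b) := by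
    ext1 x
    change M (inner ℝ a x • b) = inner ℝ a x • M b
    rw [map_smul]
  change LinearMap.trace ℝ (Vec k) ((M.comp (outerL k a b) : Vec k →L[ℝ] Vec k) :
    Vec k →ₗ[ℝ] Vec k) = _
  rw [h, LinearMap.trace_smulRight]
  rfl

theorem traceL_comp_wedge (M : Vec k →L[ℝ] Vec k) (a b : Vec k) :
    traceL k (M.comp (wedge a b)) = inner ℝ a (M b) - inner ℝ b (M a) := by
  rw [wedge, ContinuousLinearMap.comp_sub, map_sub, traceL_comp_outerL, traceL_comp_outerL]

/-- The pairing becomes bilinear in `M` and `a ∧ b` through the trace form, a shape to which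
skew-adjointness of `D_X⁻¹` on operator-valued fields applies. -/
theorem IsSkewEnd.inner_eq_traceL {M : Vec k →L[ℝ] Vec k} (hM : IsSkewEnd M) (a b : Vec k) :
    inner ℝ b (M a) = -(1 / 2) * traceL k (M.comp (wedge a b)) := by
  have := hM b a
  rw [real_inner_comm] at this
  rw [traceL_comp_wedge, this]
  ring

end Wedge

/-! ### The `L²` pairing and the nonlocal terms -/

section Nonlocal

variable {k : ℕ}

/-- The `L²` pairing of rapidly decreasing fields. -/
noncomputable def l2 (ξ X : SField k) : ℝ := ∫ l, inner ℝ (ξ l) (X l)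

theorem integrable_inner (ξ X : SField k) : Integrable fun l => inner ℝ (ξ l) (X l) :=
  (dotField ξ X).integrable

theorem l2_add_right (ξ X Y : SField k) : l2 ξ (X + Y) = l2 ξ X + l2 ξ Y := by
  rw [l2, l2, l2, ← integral_add (integrable_inner ξ X) (integrable_inner ξ Y)]
  simp [inner_add_right]

theorem l2_derivCLM (ξ X : SField k) :
    l2 ξ (SchwartzMap.derivCLM ℝ _ X) = -l2 X (SchwartzMap.derivCLM ℝ _ ξ) := by
  have h : ∫ l, inner ℝ (ξ l) (deriv X l) = -∫ l, inner ℝ (deriv ξ l) (X l) :=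
    SchwartzMap.integral_bilinear_deriv_right_eq_neg_left ξ X (innerSL ℝ)
  simp only [l2, SchwartzMap.derivCLM_apply]
  rw [h]
  simp only [real_inner_comm]

/-- The field `D_X⁻¹(f) c`. -/
noncomputable def nonlocalSMul (f : 𝓢(ℝ, ℝ)) (c : SField k) : SField k :=
  SchwartzMap.bilinLeftCLM (ContinuousLinearMap.lsmul ℝ ℝ).flip (antideriv_hasTemperateGrowth f) c

/-- The field `c ⌋ D_X⁻¹(M)`. -/
noncomputable def nonlocalApply (M : 𝓢(ℝ, Vec k →L[ℝ] Vec k)) (c : SField k) : SField k :=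
  SchwartzMap.bilinLeftCLM (ContinuousLinearMap.id ℝ (Vec k →L[ℝ] Vec k)).flip
    (antideriv_hasTemperateGrowth M) c

theorem nonlocalSMul_apply (f : 𝓢(ℝ, ℝ)) (c : SField k) (l : ℝ) :
    nonlocalSMul f c l = antideriv f l • c l := rfl

theorem nonlocalApply_apply (M : 𝓢(ℝ, Vec k →L[ℝ] Vec k)) (c : SField k) (l : ℝ) :
    nonlocalApply M c l = antideriv M l (c l) := rfl

theorem opJ_eq (v X : SField k) :
    opJ v X = SchwartzMap.derivCLM ℝ (Vec k) X + nonlocalSMul (dotField v X) v := rfl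

theorem opH_eq (v ξ : SField k) :
    opH v ξ = SchwartzMap.derivCLM ℝ (Vec k) ξ + nonlocalApply (wedgeField v ξ) v := rfl

theorem dotField_comm (v X : SField k) : dotField v X = dotField X v := by
  ext l
  simp only [dotField_apply, real_inner_comm]

theorem l2_nonlocalSMul (X c : SField k) (f : 𝓢(ℝ, ℝ)) :
    l2 X (nonlocalSMul f c) = ∫ l, antideriv f l * dotField c X l := by
  refine integral_congr_ae (.of_forall fun l => ?_)
  simp only [nonlocalSMul_apply, dotField_apply, real_inner_smul_right, real_inner_comm]

theorem integral_antideriv_mul (f g : 𝓢(ℝ, ℝ)) :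
    ∫ l, antideriv f l * g l = -∫ l, antideriv g l * f l := by
  have h := integral_bilin_antideriv (ContinuousLinearMap.mul ℝ ℝ) f g
  simp only [ContinuousLinearMap.mul_apply'] at h
  rw [h]
  simp only [mul_comm]

/-- Skew-adjointness of `D_X⁻¹` on scalar fields, with four independent fields; `b = c = v` is the
case of the nonlocal term of `J`. -/
theorem l2_nonlocalSMul_dotField (X a b c : SField k) :
    l2 X (nonlocalSMul (dotField a b) c) = -l2 a (nonlocalSMul (dotField c X) b) := by
  rw [l2_nonlocalSMul, l2_nonlocalSMul, integral_antideriv_mul, dotField_comm b a]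

/-- Both sides are `∓½ ∫ tr(D_X⁻¹(·) ∘ ·)` of the same two skew products, with `D_X⁻¹` on one or the
other. The case `a = c = v` is the nonlocal term of `H`; the general case is needed for `derivH`. -/
theorem l2_nonlocalApply_wedgeField (X a b c : SField k) :
    l2 X (nonlocalApply (wedgeField a b) c) = -l2 b (nonlocalApply (wedgeField c X) a) := by
  have key : ∀ X a b c : SField k, l2 X (nonlocalApply (wedgeField a b) c)
      = -(1 / 2) * ∫ l, traceL k ((antideriv (wedgeField a b) l).comp (wedgeField c X l)) := by
    intro X a b c
    rw [← integral_const_mul]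
    refine integral_congr_ae (.of_forall fun l => ?_)
    exact (isSkewEnd_antideriv_wedgeField a b l).inner_eq_traceL (c l) (X l)
  have h := integral_bilin_antideriv (((ContinuousLinearMap.compL ℝ (Vec k →L[ℝ] Vec k)
    (Vec k →L[ℝ] Vec k) ℝ) (traceL k)).comp (ContinuousLinearMap.compL ℝ (Vec k) (Vec k) (Vec k)))
    (wedgeField a b) (wedgeField c X)
  simp only [ContinuousLinearMap.comp_apply, ContinuousLinearMap.compL_apply] at h
  rw [key, key, h]
  simp only [traceL_comp_comm]
  ring

end Nonlocal

/-! ### Linearity and polynomial dependence on the base point -/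

section Expansion

variable {k : ℕ}

theorem dotField_add_left (u v X : SField k) :
    dotField (u + v) X = dotField u X + dotField v X := by
  ext l; simp [dotField_apply, inner_add_left]

theorem dotField_add_right (u v X : SField k) :
    dotField X (u + v) = dotField X u + dotField X v := by
  ext l; simp [dotField_apply, inner_add_right]

theorem dotField_smul_left (t : ℝ) (v X : SField k) : dotField (t • v) X = t • dotField v X := by
  ext l; simp [dotField_apply, real_inner_smul_left]

theorem dotField_smul_right (t : ℝ) (v X : SField k) : dotField X (t • v) = t • dotField X v := by
  ext l; simp [dotField_apply, real_inner_smul_right]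

theorem wedgeField_add_left (u v X : SField k) :
    wedgeField (u + v) X = wedgeField u X + wedgeField v X := by
  ext1 l; ext1 a
  simp only [add_apply, wedgeField_apply, inner_add_left]
  module

theorem wedgeField_neg_comm (v X : SField k) : wedgeField v X = -wedgeField X v :=
  (neg_sub _ _).symm

theorem wedgeField_add_right (u v X : SField k) :
    wedgeField X (u + v) = wedgeField X u + wedgeField X v := by
  rw [wedgeField_neg_comm, wedgeField_add_left, neg_add, ← wedgeField_neg_comm,
    ← wedgeField_neg_comm]

theorem wedgeField_smul_left (t : ℝ) (v X : SField k) :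
    wedgeField (t • v) X = t • wedgeField v X := by
  ext1 l; ext1 a
  simp only [smul_apply, wedgeField_apply, real_inner_smul_left]
  module

theorem wedgeField_smul_right (t : ℝ) (v X : SField k) :
    wedgeField X (t • v) = t • wedgeField X v := by
  rw [wedgeField_neg_comm, wedgeField_smul_left, ← smul_neg, ← wedgeField_neg_comm]

theorem nonlocalSMul_add_left (f g : 𝓢(ℝ, ℝ)) (c : SField k) :
    nonlocalSMul (f + g) c = nonlocalSMul f c + nonlocalSMul g c := by
  ext1 l
  simp only [nonlocalSMul_apply, add_apply, antideriv_add, add_smul]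

theorem nonlocalSMul_smul_left (t : ℝ) (f : 𝓢(ℝ, ℝ)) (c : SField k) :
    nonlocalSMul (t • f) c = t • nonlocalSMul f c := by
  ext1 l
  simp only [nonlocalSMul_apply, smul_apply, antideriv_smul, smul_assoc]

theorem nonlocalSMul_add_right (f : 𝓢(ℝ, ℝ)) (c d : SField k) :
    nonlocalSMul f (c + d) = nonlocalSMul f c + nonlocalSMul f d := map_add _ _ _

theorem nonlocalSMul_smul_right (t : ℝ) (f : 𝓢(ℝ, ℝ)) (c : SField k) :
    nonlocalSMul f (t • c) = t • nonlocalSMul f c := map_smul _ _ _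

theorem nonlocalApply_add_left (M P : 𝓢(ℝ, Vec k →L[ℝ] Vec k)) (c : SField k) :
    nonlocalApply (M + P) c = nonlocalApply M c + nonlocalApply P c := by
  ext1 l
  simp only [nonlocalApply_apply, add_apply, antideriv_add]

theorem nonlocalApply_smul_left (t : ℝ) (M : 𝓢(ℝ, Vec k →L[ℝ] Vec k)) (c : SField k) :
    nonlocalApply (t • M) c = t • nonlocalApply M c := by
  ext1 l
  simp only [nonlocalApply_apply, smul_apply, antideriv_smul]

theorem nonlocalApply_add_right (M : 𝓢(ℝ, Vec k →L[ℝ] Vec k)) (c d : SField k) :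
    nonlocalApply M (c + d) = nonlocalApply M c + nonlocalApply M d := map_add _ _ _

theorem nonlocalApply_smul_right (t : ℝ) (M : 𝓢(ℝ, Vec k →L[ℝ] Vec k)) (c : SField k) :
    nonlocalApply M (t • c) = t • nonlocalApply M c := map_smul _ _ _

theorem opJ_add (v X Y : SField k) : opJ v (X + Y) = opJ v X + opJ v Y := by
  simp only [opJ_eq, map_add, dotField_add_right, nonlocalSMul_add_left]
  abel

theorem opJ_smul (v : SField k) (t : ℝ) (X : SField k) : opJ v (t • X) = t • opJ v X := by
  simp only [opJ_eq, map_smul, dotField_smul_right, nonlocalSMul_smul_left, smul_add]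

theorem opH_add (v X Y : SField k) : opH v (X + Y) = opH v X + opH v Y := by
  simp only [opH_eq, map_add, wedgeField_add_right, nonlocalApply_add_left]
  abel

theorem opH_smul (v : SField k) (t : ℝ) (X : SField k) : opH v (t • X) = t • opH v X := by
  simp only [opH_eq, map_smul, wedgeField_smul_right, nonlocalApply_smul_left, smul_add]

/-- The derivative of `v ↦ J_v X` in the direction `W`. -/
noncomputable def derivJ (v W X : SField k) : SField k :=
  nonlocalSMul (dotField W X) v + nonlocalSMul (dotField v X) W

/-- The derivative of `v ↦ H_v ξ` in the direction `W`. -/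
noncomputable def derivH (v W ξ : SField k) : SField k :=
  nonlocalApply (wedgeField W ξ) v + nonlocalApply (wedgeField v ξ) W

/-- The derivative of `v ↦ ℜ_v X` in the direction `W`. -/
noncomputable def derivR (v W X : SField k) : SField k :=
  derivH v W (opJ v X) + opH v (derivJ v W X)

theorem opJ_add_smul (v W X : SField k) (t : ℝ) :
    opJ (v + t • W) X = opJ v X + t • derivJ v W X + t ^ 2 • nonlocalSMul (dotField W X) W := by
  simp only [opJ_eq, derivJ, dotField_add_left, dotField_smul_left, nonlocalSMul_add_left,
    nonlocalSMul_smul_left, nonlocalSMul_add_right, nonlocalSMul_smul_right]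
  module

theorem opH_add_smul (v W ξ : SField k) (t : ℝ) :
    opH (v + t • W) ξ = opH v ξ + t • derivH v W ξ + t ^ 2 • nonlocalApply (wedgeField W ξ) W := by
  simp only [opH_eq, derivH, wedgeField_add_left, wedgeField_smul_left, nonlocalApply_add_left,
    nonlocalApply_smul_left, nonlocalApply_add_right, nonlocalApply_smul_right]
  module

/-- The difference quotient is `Z + t P(t)` for `t ≠ 0`. Since the operators depend polynomially on
`v`, exact expansions replace estimates in the Schwartz seminorms. -/
theorem HasDirDeriv.of_expansion {E : Type*} [AddCommGroup E] [Module ℝ E] [TopologicalSpace E]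
    [ContinuousAdd E] [ContinuousSMul ℝ E] {A : E → E} {v W Z : E} {P : ℝ → E} (hP : Continuous P)
    (h : ∀ t : ℝ, A (v + t • W) = A v + t • Z + t ^ 2 • P t) : HasDirDeriv A v W Z := by
  have hc : Continuous fun t : ℝ => Z + t • P t := by fun_prop
  have h0 : Tendsto (fun t : ℝ => Z + t • P t) (𝓝[≠] 0) (𝓝 Z) := by
    have := hc.tendsto 0
    rw [zero_smul, add_zero] at this
    exact this.mono_left nhdsWithin_le_nhds
  refine h0.congr' ?_
  filter_upwards [self_mem_nhdsWithin] with t ht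
  rw [h t, add_assoc, add_sub_cancel_left, smul_add, smul_smul, smul_smul, inv_mul_cancel₀ ht,
    one_smul, pow_two, inv_mul_cancel_left₀ ht]

theorem hasDirDeriv_opJ (v W X : SField k) :
    HasDirDeriv (fun u => opJ u X) v W (derivJ v W X) :=
  .of_expansion continuous_const fun t => opJ_add_smul v W X t

theorem hasDirDeriv_opH (v W ξ : SField k) :
    HasDirDeriv (fun u => opH u ξ) v W (derivH v W ξ) :=
  .of_expansion continuous_const fun t => opH_add_smul v W ξ t

theorem hasDirDeriv_opR (v W X : SField k) :
    HasDirDeriv (fun u => opR u X) v W (derivR v W X) := by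
  let X₁ := derivJ v W X
  let X₂ := nonlocalSMul (dotField W X) W
  let Q : SField k → SField k := fun ξ => nonlocalApply (wedgeField W ξ) W
  -- Here `J_{v+tW} X = J_v X + t X₁ + t² X₂`, and `Q` is the second-order coefficient of `H`. The
  -- composite has degree four in `t`; `P` collects the orders two, three and four.
  refine .of_expansion (P := fun t : ℝ => (opH v X₂ + derivH v W X₁ + Q (opJ v X))
    + t • (derivH v W X₂ + Q X₁) + t ^ 2 • Q X₂) (by fun_prop) fun t => ?_
  simp only [opR, derivR]
  rw [opJ_add_smul, opH_add, opH_add, opH_smul, opH_smul, opH_add_smul, opH_add_smul, opH_add_smul]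
  module

theorem IsOperatorDeriv.prodMk {E F : Type*} [AddCommGroup E] [Module ℝ E] [TopologicalSpace E]
    [AddCommGroup F] [Module ℝ F] [TopologicalSpace F] {A : E → E → E} {A' : E → E → E → E}
    {B : F → F → F} {B' : F → F → F → F} (hA : IsOperatorDeriv A A') (hB : IsOperatorDeriv B B') :
    IsOperatorDeriv (fun v X : E × F => (A v.1 X.1, B v.2 X.2))
      (fun v W X => (A' v.1 W.1 X.1, B' v.2 W.2 X.2)) := fun v W X =>
  Tendsto.prodMk_nhds (hA v.1 W.1 X.1) (hB v.2 W.2 X.2)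

end Expansion

/-! ### Skew-adjointness, closedness and the Jacobi identity -/

section Identities

variable {k : ℕ}

theorem l2_opJ (v X Y : SField k) : l2 X (opJ v Y) = -l2 Y (opJ v X) := by
  rw [opJ_eq, opJ_eq, l2_add_right, l2_add_right, l2_derivCLM X Y, dotField_comm v Y,
    l2_nonlocalSMul_dotField]
  ring

theorem l2_opH (v ξ η : SField k) : l2 ξ (opH v η) = -l2 η (opH v ξ) := by
  rw [opH_eq, opH_eq, l2_add_right, l2_add_right, l2_derivCLM ξ η, l2_nonlocalApply_wedgeField]
  ring

/-- The six terms have the form `∫ D_X⁻¹(a · b) (v · c)` or `∫ D_X⁻¹(v · c) (a · b)` and cancel in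
pairs by skew-adjointness of `D_X⁻¹`. -/
theorem l2_derivJ_cyclic (v X Y Z : SField k) :
    l2 X (derivJ v Z Y) + l2 Y (derivJ v X Z) + l2 Z (derivJ v Y X) = 0 := by
  simp only [derivJ, l2_add_right, l2_nonlocalSMul]
  have h1 := integral_antideriv_mul (dotField Z Y) (dotField v X)
  have h2 := integral_antideriv_mul (dotField X Z) (dotField v Y)
  have h3 := integral_antideriv_mul (dotField Y X) (dotField v Z)
  rw [dotField_comm Z X, dotField_comm X Y, dotField_comm Y Z, h1, h2, h3]
  ring

theorem tendsto_antideriv_of_integral_eq_zero {F : Type*} [NormedAddCommGroup F] [NormedSpace ℝ F]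
    [CompleteSpace F] {f : 𝓢(ℝ, F)} (hf : ∫ l, f l = 0) :
    Tendsto (antideriv f) atTop (𝓝 0) ∧ Tendsto (antideriv f) atBot (𝓝 0) := by
  have h1 := tendsto_antideriv_atTop f
  have h2 := tendsto_antideriv_atBot f
  rw [hf, smul_zero] at h1 h2
  rw [neg_zero] at h2
  exact ⟨h1, h2⟩

/-- The direction `W` is moved out of `D_X⁻¹`. The antiderivatives that remain involve `v` and one
covector each, so in the Jacobi sum only `D_X⁻¹(v ∧ ξ)`, `D_X⁻¹(v ∧ η)` and `D_X⁻¹(v ∧ ζ)` occur. -/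
theorem l2_derivH_eq (v W ξ ζ : SField k) : l2 ξ (derivH v W ζ)
    = l2 ξ (nonlocalApply (wedgeField v ζ) W) - l2 ζ (nonlocalApply (wedgeField v ξ) W) := by
  rw [derivH, l2_add_right, l2_nonlocalApply_wedgeField]
  ring

theorem IsSkewEnd.inner_comm {M : Vec k →L[ℝ] Vec k} (hM : IsSkewEnd M) (x y : Vec k) :
    inner ℝ x (M y) = -inner ℝ y (M x) := by
  rw [real_inner_comm, hM]

theorem IsSkewEnd.inner_comm_comp {M P : Vec k →L[ℝ] Vec k} (hM : IsSkewEnd M) (hP : IsSkewEnd P)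
    (x y : Vec k) : inner ℝ x (M (P y)) = inner ℝ y (P (M x)) := by
  rw [hM.inner_comm, hP, neg_neg]

/-- The function whose derivative is the density of the Schouten bracket of `H`. -/
noncomputable def jacobiPotential (p : (Vec k × Vec k × Vec k) ×
    ((Vec k →L[ℝ] Vec k) × (Vec k →L[ℝ] Vec k) × (Vec k →L[ℝ] Vec k))) : ℝ :=
  inner ℝ p.1.2.1 (p.2.1 p.1.2.2) + inner ℝ p.1.2.2 (p.2.2.1 p.1.1)
    + inner ℝ p.1.1 (p.2.2.2 p.1.2.1) + traceL k (p.2.1.comp (p.2.2.1.comp p.2.2.2))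

theorem continuous_jacobiPotential : Continuous (jacobiPotential (k := k)) := by
  unfold jacobiPotential
  fun_prop

/-- The cyclic sum is the integral of a total derivative, that of `jacobiPotential`. The integral
conditions kill the boundary values of its trace term, which is cubic in the antiderivatives and
would in general take opposite nonzero values at the two ends. -/
theorem l2_derivH_cyclic {v ξ η ζ : SField k} (hξ : ∫ l, wedgeField v ξ l = 0)
    (hη : ∫ l, wedgeField v η l = 0) (hζ : ∫ l, wedgeField v ζ l = 0) :
    l2 ξ (derivH v (opH v η) ζ) + l2 η (derivH v (opH v ζ) ξ) + l2 ζ (derivH v (opH v ξ) η) = 0 := by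
  -- The pointwise density of `⟨a, H'[H c] b⟩`, after `W = H c` has been freed from the
  -- antiderivative.
  let K (a b c : SField k) : 𝓢(ℝ, ℝ) := dotField a (nonlocalApply (wedgeField v b) (opH v c))
    - dotField b (nonlocalApply (wedgeField v a) (opH v c))
  have hK : ∀ a b c, l2 a (derivH v (opH v c) b) = ∫ l, K a b c l := fun a b c => by
    rw [l2_derivH_eq]
    exact (integral_sub (integrable_inner _ _) (integrable_inner _ _)).symm
  have hs : ∀ f g : 𝓢(ℝ, ℝ), (∫ l, f l) + ∫ l, g l = ∫ l, (f + g) l := fun f g =>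
    (integral_add f.integrable g.integrable).symm
  rw [hK, hK, hK, hs, hs]
  let Φ : ℝ → ℝ := fun l => jacobiPotential ((ξ l, η l, ζ l),
    (antideriv (wedgeField v ξ) l, antideriv (wedgeField v η) l, antideriv (wedgeField v ζ) l))
  have hlim : jacobiPotential (k := k) ((0, 0, 0), (0, 0, 0)) = 0 := by simp [jacobiPotential]
  obtain ⟨tξ, bξ⟩ := tendsto_antideriv_of_integral_eq_zero hξ
  obtain ⟨tη, bη⟩ := tendsto_antideriv_of_integral_eq_zero hη
  obtain ⟨tζ, bζ⟩ := tendsto_antideriv_of_integral_eq_zero hζ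
  have ht : Tendsto Φ atTop (𝓝 0) := by
    rw [← hlim]
    exact (continuous_jacobiPotential.tendsto _).comp
      ((ξ.tendsto_atTop.prodMk_nhds (η.tendsto_atTop.prodMk_nhds ζ.tendsto_atTop)).prodMk_nhds
        (tξ.prodMk_nhds (tη.prodMk_nhds tζ)))
  have hb : Tendsto Φ atBot (𝓝 0) := by
    rw [← hlim]
    exact (continuous_jacobiPotential.tendsto _).comp
      ((ξ.tendsto_atBot.prodMk_nhds (η.tendsto_atBot.prodMk_nhds ζ.tendsto_atBot)).prodMk_nhds
        (bξ.prodMk_nhds (bη.prodMk_nhds bζ)))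
  rw [integral_of_hasDerivAt_of_tendsto (f := Φ) (fun l => ?_)
    (K ξ ζ η + K η ξ ζ + K ζ η ξ).integrable hb ht, sub_zero]
  have dξ := ξ.hasDerivAt l
  have dη := η.hasDerivAt l
  have dζ := ζ.hasDerivAt l
  have eξ := hasDerivAt_antideriv (wedgeField v ξ) l
  have eη := hasDerivAt_antideriv (wedgeField v η) l
  have eζ := hasDerivAt_antideriv (wedgeField v ζ) l
  have hd := (((dη.inner ℝ (eξ.clm_apply dζ)).add (dζ.inner ℝ (eη.clm_apply dξ))).add
    (dξ.inner ℝ (eζ.clm_apply dη))).add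
    ((traceL k).hasFDerivAt.comp_hasDerivAt l (eξ.clm_comp (eη.clm_comp eζ)))
  refine hd.congr_deriv ?_
  have sξ := isSkewEnd_antideriv_wedgeField v ξ l
  have sη := isSkewEnd_antideriv_wedgeField v η l
  have sζ := isSkewEnd_antideriv_wedgeField v ζ l
  simp only [K, add_apply, sub_apply, dotField_apply, nonlocalApply_apply, opH_apply, wedgeField_eq]
  generalize antideriv (wedgeField v ξ) l = Ξ at *
  generalize antideriv (wedgeField v η) l = N at *
  generalize antideriv (wedgeField v ζ) l = Z at *
  -- The derivative of `tr(ΞNZ)` has one factor `v ∧ ·` in each position; cyclicity of the trace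
  -- moves it to the end, where the trace becomes a difference of inner products.
  have t1 : traceL k ((wedge (v l) (ξ l)).comp (N.comp Z))
      = inner ℝ (v l) (N (Z (ξ l))) - inner ℝ (ξ l) (N (Z (v l))) := by
    rw [traceL_comp_comm, traceL_comp_wedge]; rfl
  have t2 : traceL k (Ξ.comp ((wedge (v l) (η l)).comp Z))
      = inner ℝ (v l) (Z (Ξ (η l))) - inner ℝ (η l) (Z (Ξ (v l))) := by
    rw [traceL_comp_comm, ContinuousLinearMap.comp_assoc, traceL_comp_comm, traceL_comp_wedge]; rfl
  have t3 : traceL k (Ξ.comp (N.comp (wedge (v l) (ζ l))))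
      = inner ℝ (v l) (Ξ (N (ζ l))) - inner ℝ (ζ l) (Ξ (N (v l))) := by
    rw [← ContinuousLinearMap.comp_assoc, traceL_comp_wedge]; rfl
  simp only [ContinuousLinearMap.comp_add, map_add, t1, t2, t3, inner_add_right, inner_apply_wedge]
  -- The three groups treat the terms with a differentiated covector, the terms with two
  -- antiderivatives and two vectors, and the products of inner products of `v, ξ, η, ζ`.
  linear_combination sξ.inner_comm (deriv η l) (ζ l) + sη.inner_comm (deriv ζ l) (ξ l)
    + sζ.inner_comm (deriv ξ l) (η l) + sη.inner_comm_comp sζ (v l) (ξ l)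
    + sζ.inner_comm_comp sξ (v l) (η l) + sξ.inner_comm_comp sη (v l) (ζ l)
    + inner ℝ (v l) (ζ l) * real_inner_comm (η l) (ξ l)
    + inner ℝ (v l) (ξ l) * real_inner_comm (ζ l) (η l)
    + inner ℝ (v l) (η l) * real_inner_comm (ξ l) (ζ l)

end Identities

/-! ### Invariance under orthogonal transformations -/

section Invariance

variable {k : ℕ}

/-- The action of an orthogonal transformation on fields. -/
noncomputable abbrev rotate (ρ : Vec k ≃ₗᵢ[ℝ] Vec k) (X : SField k) : SField k :=
  SchwartzMap.postcompCLM ρ.toContinuousLinearEquiv.toContinuousLinearMap X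

theorem rotate_apply (ρ : Vec k ≃ₗᵢ[ℝ] Vec k) (X : SField k) (l : ℝ) : rotate ρ X l = ρ (X l) := rfl

theorem rotate_add (ρ : Vec k ≃ₗᵢ[ℝ] Vec k) (X Y : SField k) :
    rotate ρ (X + Y) = rotate ρ X + rotate ρ Y := map_add _ _ _

theorem derivCLM_postcompCLM {F G : Type*} [NormedAddCommGroup F] [NormedSpace ℝ F]
    [NormedAddCommGroup G] [NormedSpace ℝ G] (L : F →L[ℝ] G) (X : 𝓢(ℝ, F)) :
    SchwartzMap.derivCLM ℝ G (X.postcompCLM L)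
      = (SchwartzMap.derivCLM ℝ F X).postcompCLM L := by
  ext1 l
  simp only [SchwartzMap.derivCLM_apply, SchwartzMap.postcompCLM_apply]
  exact (L.hasFDerivAt.comp_hasDerivAt l (X.hasDerivAt l)).deriv

theorem dotField_rotate (ρ : Vec k ≃ₗᵢ[ℝ] Vec k) (v X : SField k) :
    dotField (rotate ρ v) (rotate ρ X) = dotField v X := by
  ext1 l
  simp only [dotField_apply, rotate_apply, LinearIsometryEquiv.inner_map_map]

theorem opJ_rotate (ρ : Vec k ≃ₗᵢ[ℝ] Vec k) (v X : SField k) :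
    opJ (rotate ρ v) (rotate ρ X) = rotate ρ (opJ v X) := by
  rw [opJ_eq, opJ_eq, dotField_rotate, derivCLM_postcompCLM, rotate_add]
  congr 1
  ext1 l
  exact (map_smul ρ _ _).symm

/-- Pointwise `(ρv ∧ ρX) ∘ ρ = ρ ∘ (v ∧ X)`. Evaluating at a fixed vector makes both sides linear
images of the fields, and these commute with `D_X⁻¹`. -/
theorem antideriv_wedgeField_rotate (ρ : Vec k ≃ₗᵢ[ℝ] Vec k) (v X : SField k) (l : ℝ) (a : Vec k) :
    antideriv (wedgeField (rotate ρ v) (rotate ρ X)) l (ρ a)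
      = ρ (antideriv (wedgeField v X) l a) := by
  have h : (wedgeField (rotate ρ v) (rotate ρ X)).postcompCLM
      (ContinuousLinearMap.apply ℝ (Vec k) (ρ a)) = (wedgeField v X).postcompCLM
      (ρ.toContinuousLinearEquiv.toContinuousLinearMap.comp
        (ContinuousLinearMap.apply ℝ (Vec k) a)) := by
    ext1 l
    change wedge (ρ (v l)) (ρ (X l)) (ρ a) = ρ (wedge (v l) (X l) a)
    simp only [wedge_apply, LinearIsometryEquiv.inner_map_map, map_sub, map_smul]
  have h1 := ContinuousLinearMap.antideriv_postcomp (ContinuousLinearMap.apply ℝ (Vec k) (ρ a))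
    (wedgeField (rotate ρ v) (rotate ρ X)) l
  rw [h, ContinuousLinearMap.antideriv_postcomp] at h1
  exact h1.symm

theorem opH_rotate (ρ : Vec k ≃ₗᵢ[ℝ] Vec k) (v X : SField k) :
    opH (rotate ρ v) (rotate ρ X) = rotate ρ (opH v X) := by
  rw [opH_eq, opH_eq, derivCLM_postcompCLM, rotate_add]
  congr 1
  ext1 l
  exact antideriv_wedgeField_rotate ρ v X l (v l)

end Invariance

/-! ### The pairs of operators -/

section Pairs

variable {p q : ℕ}

theorem dPair_eq (ξ X : DField p q) : dPair ξ X = l2 ξ.1 X.1 + l2 ξ.2 X.2 := rfl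

theorem isSymplecticOperator_dJ : IsSymplecticOperator (dPair (p := p) (q := q)) dJ := by
  refine ⟨fun v => ⟨fun X Y => Prod.ext (opJ_add _ _ _) (opJ_add _ _ _),
    fun t X => Prod.ext (opJ_smul _ _ _) (opJ_smul _ _ _)⟩, fun v X Y => ?_,
    fun v W X => (derivJ v.1 W.1 X.1, derivJ v.2 W.2 X.2),
    IsOperatorDeriv.prodMk hasDirDeriv_opJ hasDirDeriv_opJ,
    fun v X Y Z => ?_⟩
  · simp only [dPair_eq, dJ]
    linear_combination l2_opJ v.1 X.1 Y.1 + l2_opJ v.2 X.2 Y.2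
  · simp only [dPair_eq]
    linear_combination l2_derivJ_cyclic v.1 X.1 Y.1 Z.1 + l2_derivJ_cyclic v.2 X.2 Y.2 Z.2

theorem isCosymplecticOperator_dH :
    IsCosymplecticOperator (dPair (p := p) (q := q)) dDomH dH := by
  refine ⟨fun v => ⟨fun X Y => Prod.ext (opH_add _ _ _) (opH_add _ _ _),
    fun t X => Prod.ext (opH_smul _ _ _) (opH_smul _ _ _)⟩, fun v ξ η => ?_,
    fun v W X => (derivH v.1 W.1 X.1, derivH v.2 W.2 X.2),
    IsOperatorDeriv.prodMk hasDirDeriv_opH hasDirDeriv_opH,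
    fun v ξ hξ η hη ζ hζ => ?_⟩
  · simp only [dPair_eq, dH]
    linear_combination l2_opH v.1 ξ.1 η.1 + l2_opH v.2 ξ.2 η.2
  · simp only [dPair_eq, dH]
    linear_combination l2_derivH_cyclic hξ.1 hη.1 hζ.1 + l2_derivH_cyclic hξ.2 hη.2 hζ.2

end Pairs

/-! ### The recursion operator is hereditary -/

section Hereditary

variable {k : ℕ}

theorem wedge_sub_right (a b c : Vec k) : wedge a (b - c) = wedge a b - wedge a c := by
  simp only [wedge, map_sub, sub_apply]
  abel

theorem wedge_add_right (a b c : Vec k) : wedge a (b + c) = wedge a b + wedge a c := by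
  simp only [wedge, map_add, add_apply]
  abel

theorem wedge_smul_right (t : ℝ) (a b : Vec k) : wedge a (t • b) = t • wedge a b := by
  simp only [wedge, map_smul, smul_apply, smul_sub]

theorem wedge_self (a : Vec k) : wedge a a = 0 := sub_self _

theorem wedge_neg_comm (a b : Vec k) : wedge a b = -wedge b a := (neg_sub _ _).symm

theorem wedge_add_left (a b c : Vec k) : wedge (a + b) c = wedge a c + wedge b c := by
  simp only [wedge, map_add, add_apply]
  abel

theorem HasDerivAt.wedge {f g : ℝ → Vec k} {f' g' : Vec k} {l : ℝ} (hf : HasDerivAt f f' l)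
    (hg : HasDerivAt g g' l) :
    HasDerivAt (fun s => wedge (f s) (g s)) (_root_.wedge f' (g l) + _root_.wedge (f l) g') l := by
  have h1 := (outerL k).hasDerivAt_of_bilinear (fun _ => hf) (fun _ => hg)
  have h2 := (outerL k).hasDerivAt_of_bilinear (fun _ => hg) (fun _ => hf)
  refine (h1.fun_sub h2).congr_deriv ?_
  simp only [_root_.wedge]
  abel

/-- A skew endomorphism acts on skew products as a derivation. This evaluates the derivative of the
commutator of two antiderivatives. -/
theorem IsSkewEnd.comp_wedge_sub {M : Vec k →L[ℝ] Vec k} (hM : IsSkewEnd M) (a b : Vec k) :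
    M.comp (wedge a b) - (wedge a b).comp M = wedge a (M b) + wedge (M a) b := by
  ext1 x
  simp only [sub_apply, add_apply, ContinuousLinearMap.comp_apply, wedge_apply, map_sub, map_smul,
    hM a x, hM b x]
  module

/-- The two wedge terms `W ∧ J_v Y` and `v ∧ J'[W]Y` combine: the parts with `D_X⁻¹(v · Y)` cancel
because `W ∧ v = -(v ∧ W)`, the rest of `v ∧ J'[W]Y` contains `v ∧ v = 0`, and only `W ∧ D_X Y` is
left. -/
theorem derivR_apply (v W Y : SField k) (l : ℝ) :
    derivR v W Y l
      = deriv (derivJ v W Y) l + antideriv (wedgeField v (opJ v Y)) l (W l)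
        + antideriv (wedgeField W (SchwartzMap.derivCLM ℝ _ Y)) l (v l) := by
  have h : wedgeField W (SchwartzMap.derivCLM ℝ _ Y)
      = wedgeField W (opJ v Y) + wedgeField v (derivJ v W Y) := by
    ext1 l
    simp only [add_apply, wedgeField_eq, opJ_eq, derivJ, nonlocalSMul_apply, wedge_add_right,
      wedge_smul_right, wedge_self, wedge_neg_comm (W l) (v l)]
    module
  rw [h, antideriv_add]
  simp only [derivR, derivH, add_apply, opH_apply, nonlocalApply_apply]
  abel

/-- Antisymmetrization removes one level of nonlocality: `X ∧ D_X Y - Y ∧ D_X X` is the exact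
derivative of `X ∧ Y`. What remains contains only single antiderivatives of `v · X`, `v · Y`, `v ∧
JX` and `v ∧ JY`. -/
theorem derivR_sub_derivR_apply (v X Y : SField k) (l : ℝ) :
    (derivR v X Y - derivR v Y X) l
      = antideriv (dotField v Y) l • deriv X l - antideriv (dotField v X) l • deriv Y l
        + antideriv (wedgeField v (opJ v Y)) l (X l)
        - antideriv (wedgeField v (opJ v X)) l (Y l) := by
  have h : derivJ v X Y - derivJ v Y X
      = nonlocalSMul (dotField v Y) X - nonlocalSMul (dotField v X) Y := by
    rw [derivJ, derivJ, dotField_comm Y X]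
    abel
  have hd : deriv (derivJ v X Y) l - deriv (derivJ v Y X) l
      = dotField v Y l • X l + antideriv (dotField v Y) l • deriv X l
        - (dotField v X l • Y l + antideriv (dotField v X) l • deriv Y l) := by
    rw [← ((derivJ v X Y).hasDerivAt l |>.sub ((derivJ v Y X).hasDerivAt l)).deriv]
    have e : ⇑(derivJ v X Y) - ⇑(derivJ v Y X) = fun s =>
        antideriv (dotField v Y) s • X s - antideriv (dotField v X) s • Y s := by
      funext s
      exact DFunLike.congr_fun h s
    rw [e]
    refine (((hasDerivAt_antideriv _ l).fun_smul (X.hasDerivAt l)).fun_sub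
      ((hasDerivAt_antideriv _ l).fun_smul (Y.hasDerivAt l))).deriv.trans ?_
    abel
  have hw : antideriv (wedgeField X (SchwartzMap.derivCLM ℝ _ Y)) l
      - antideriv (wedgeField Y (SchwartzMap.derivCLM ℝ _ X)) l = wedge (X l) (Y l) := by
    rw [← antideriv_sub]
    refine antideriv_eq_of_hasDerivAt (Φ := fun s => wedge (X s) (Y s)) (fun s => ?_) ?_ l
    · refine ((X.hasDerivAt s).wedge (Y.hasDerivAt s)).congr_deriv ?_
      simp only [sub_apply, wedgeField_eq, SchwartzMap.derivCLM_apply,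
        wedge_neg_comm (Y s) (deriv X s)]
      abel
    · exact (wedgeField X Y).tendsto_add_neg
  rw [sub_apply, derivR_apply, derivR_apply]
  -- Applied to `v`, the local term `X ∧ Y` cancels the undifferentiated terms `(v · Y) X - (v · X)
  -- Y` of `hd`.
  have hw' := DFunLike.congr_fun hw (v l)
  rw [sub_apply, wedge_apply, real_inner_comm, real_inner_comm (v l) (Y l)] at hw'
  simp only [dotField_apply] at hd
  linear_combination (norm := module) hd + hw'

theorem deriv_eq_opJ_sub (v X : SField k) (l : ℝ) :
    deriv X l = opJ v X l - antideriv (dotField v X) l • v l := by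
  rw [opJ_apply, add_sub_cancel_right]

/-- The integrated form of `v · (ℜ'[X]Y - ℜ'[Y]X)`. -/
theorem antideriv_dotField_derivR_sub (v X Y : SField k) (l : ℝ) :
    antideriv (dotField v (derivR v X Y - derivR v Y X)) l
      = inner ℝ (opJ v Y l) (X l) - inner ℝ (opJ v X l) (Y l)
        + antideriv (dotField (opR v X) Y) l - antideriv (dotField (opR v Y) X) l := by
  refine antideriv_eq_of_hasDerivAt (Φ := fun l =>
    inner ℝ (opJ v Y l) (X l) - inner ℝ (opJ v X l) (Y l)
        + antideriv (dotField (opR v X) Y) l - antideriv (dotField (opR v Y) X) l) (fun s => ?_) ?_ l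
  · refine ((((opJ v Y).hasDerivAt s |>.inner ℝ (X.hasDerivAt s)).fun_sub
      ((opJ v X).hasDerivAt s |>.inner ℝ (Y.hasDerivAt s))).fun_add
      (hasDerivAt_antideriv _ s) |>.fun_sub (hasDerivAt_antideriv _ s)).congr_deriv ?_
    simp only [dotField_apply]
    rw [derivR_sub_derivR_apply]
    have hA := isSkewEnd_antideriv_wedgeField v (opJ v X) s
    have hB := isSkewEnd_antideriv_wedgeField v (opJ v Y) s
    simp only [opR, opH_apply, deriv_eq_opJ_sub v X, deriv_eq_opJ_sub v Y, inner_add_left,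
      inner_add_right, inner_sub_right,
      real_inner_smul_right, hA _ _, hB _ _]
    rw [real_inner_comm (v s) (opJ v X s), real_inner_comm (v s) (opJ v Y s),
      real_inner_comm (opJ v X s) (opJ v Y s)]
    ring
  -- Each piece is either a rapidly decreasing function or an antiderivative, hence normalized at
  -- infinity.
  · have h1 : Tendsto (fun l => inner ℝ (opJ v Y l) (X l) + inner ℝ (opJ v Y (-l)) (X (-l)))
        atTop (𝓝 0) := (dotField (opJ v Y) X).tendsto_add_neg
    have h2 : Tendsto (fun l => inner ℝ (opJ v X l) (Y l) + inner ℝ (opJ v X (-l)) (Y (-l)))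
        atTop (𝓝 0) := (dotField (opJ v X) Y).tendsto_add_neg
    have h3 := tendsto_antideriv_add_antideriv_neg (dotField (opR v X) Y)
    have h4 := tendsto_antideriv_add_antideriv_neg (dotField (opR v Y) X)
    have h := ((h1.sub h2).add h3).sub h4
    simp only [sub_zero, add_zero] at h
    refine h.congr fun l => ?_
    ring

theorem opR_apply (v X : SField k) (l : ℝ) :
    opR v X l = deriv (opJ v X) l + antideriv (wedgeField v (opJ v X)) l (v l) := rfl

theorem derivJ_sub_derivJ_apply (v V W X Y : SField k) (l : ℝ) :
    derivJ v V Y l - derivJ v W X l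
      = antideriv (dotField v Y) l • V l - antideriv (dotField v X) l • W l
        + (antideriv (dotField V Y) l - antideriv (dotField W X) l) • v l := by
  simp only [derivJ, add_apply, nonlocalSMul_apply]
  module

/-- In `J(ℜ'[X]Y - ℜ'[Y]X)` the derivative is local by the previous formula and the nonlocal
coefficient of `v` is known from `antideriv_dotField_derivR_sub`; collecting terms yields `J'` in
the directions `ℜX` and `ℜY`, up to two rotation terms. -/
theorem opJ_derivR_sub_apply (v X Y : SField k) (l : ℝ) :
    opJ v (derivR v X Y - derivR v Y X) l
      = derivJ v (opR v X) Y l - derivJ v (opR v Y) X l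
        + antideriv (wedgeField v (opJ v Y)) l (opJ v X l)
        - antideriv (wedgeField v (opJ v X)) l (opJ v Y l) := by
  -- Replacing `D_X X` by `JX - D_X⁻¹(v · X) v`, and likewise for `Y`, the products of two
  -- antiderivatives cancel.
  have e : ⇑(derivR v X Y - derivR v Y X) = fun s =>
      antideriv (dotField v Y) s • opJ v X s - antideriv (dotField v X) s • opJ v Y s
        + antideriv (wedgeField v (opJ v Y)) s (X s)
        - antideriv (wedgeField v (opJ v X)) s (Y s) := by
    funext s
    rw [derivR_sub_derivR_apply, deriv_eq_opJ_sub v X, deriv_eq_opJ_sub v Y]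
    module
  have hd := (((((hasDerivAt_antideriv (dotField v Y) l).fun_smul
    ((opJ v X).hasDerivAt l)).fun_sub ((hasDerivAt_antideriv (dotField v X) l).fun_smul
    ((opJ v Y).hasDerivAt l))).fun_add ((hasDerivAt_antideriv (wedgeField v (opJ v Y)) l).clm_apply
    (X.hasDerivAt l))).fun_sub ((hasDerivAt_antideriv (wedgeField v (opJ v X)) l).clm_apply
    (Y.hasDerivAt l))).deriv
  rw [← e] at hd
  rw [opJ_apply, hd, antideriv_dotField_derivR_sub, derivJ_sub_derivJ_apply, deriv_eq_opJ_sub v X,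
    deriv_eq_opJ_sub v Y]
  simp only [opR_apply, wedgeField_eq, wedge_apply, dotField_apply, map_sub, map_smul]
  module

/-- An explicit primitive is differentiated. The commutator in it is quadratic in the
antiderivatives, so its limits at the two ends are equal rather than opposite; the integral
conditions make them zero, as the normalization requires. -/
theorem antideriv_wedgeField_opJ_derivR_sub {v X Y : SField k}
    (hX : ∫ l, wedgeField v (opJ v X) l = 0) (hY : ∫ l, wedgeField v (opJ v Y) l = 0) (l : ℝ) :
    antideriv (wedgeField v (opJ v (derivR v X Y - derivR v Y X))) l
      = (antideriv (wedgeField v (opJ v Y)) l).comp (antideriv (wedgeField v (opJ v X)) l)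
        - (antideriv (wedgeField v (opJ v X)) l).comp (antideriv (wedgeField v (opJ v Y)) l)
        - wedge (opJ v X l) (opJ v Y l)
        + (antideriv (wedgeField (opR v X) (SchwartzMap.derivCLM ℝ _ Y)) l
          - antideriv (wedgeField (opR v Y) (SchwartzMap.derivCLM ℝ _ X)) l) := by
  refine antideriv_eq_of_hasDerivAt (Φ := fun l =>
    (antideriv (wedgeField v (opJ v Y)) l).comp (antideriv (wedgeField v (opJ v X)) l)
        - (antideriv (wedgeField v (opJ v X)) l).comp (antideriv (wedgeField v (opJ v Y)) l)
        - wedge (opJ v X l) (opJ v Y l)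
        + (antideriv (wedgeField (opR v X) (SchwartzMap.derivCLM ℝ _ Y)) l
          - antideriv (wedgeField (opR v Y) (SchwartzMap.derivCLM ℝ _ X)) l)) (fun s => ?_) ?_ l
  · have hA := hasDerivAt_antideriv (wedgeField v (opJ v X)) s
    have hB := hasDerivAt_antideriv (wedgeField v (opJ v Y)) s
    refine ((((hB.clm_comp hA).fun_sub (hA.clm_comp hB)).fun_sub
      (((opJ v X).hasDerivAt s).wedge ((opJ v Y).hasDerivAt s))).fun_add
      ((hasDerivAt_antideriv _ s).fun_sub (hasDerivAt_antideriv _ s))).congr_deriv ?_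
    -- Since `A' = v ∧ JX` and `B' = v ∧ JY`, the commutator `BA - AB` has derivative `[B, v ∧ JX] -
    -- [A, v ∧ JY]`, expanded by the derivation rule.
    have cA := (isSkewEnd_antideriv_wedgeField v (opJ v X) s).comp_wedge_sub (v s) (opJ v Y s)
    have cB := (isSkewEnd_antideriv_wedgeField v (opJ v Y) s).comp_wedge_sub (v s) (opJ v X s)
    simp only [wedgeField_eq, SchwartzMap.derivCLM_apply, opJ_derivR_sub_apply,
      derivJ_sub_derivJ_apply, deriv_eq_opJ_sub v X, deriv_eq_opJ_sub v Y, opR_apply]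
    generalize antideriv (wedgeField v (opJ v X)) s = A at *
    generalize antideriv (wedgeField v (opJ v Y)) s = B at *
    simp only [wedge_add_right, wedge_sub_right, wedge_smul_right, wedge_add_left, wedge_self,
      wedge_neg_comm (deriv _ s) (v s), wedge_neg_comm (A (v s)) (v s),
      wedge_neg_comm (B (v s)) (v s), wedge_neg_comm (deriv (opJ v Y) s) (opJ v X s)]
    linear_combination (norm := module) cB - cA
  · obtain ⟨tX, bX⟩ := tendsto_antideriv_of_integral_eq_zero hX
    obtain ⟨tY, bY⟩ := tendsto_antideriv_of_integral_eq_zero hY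
    have hc : Continuous fun p : (Vec k →L[ℝ] Vec k) × (Vec k →L[ℝ] Vec k) =>
        p.2.comp p.1 - p.1.comp p.2 := by fun_prop
    have h1 := ((hc.tendsto _).comp (tX.prodMk_nhds tY)).add
      (((hc.tendsto _).comp (bX.prodMk_nhds bY)).comp tendsto_neg_atTop_atBot)
    have h2 : Tendsto (fun l => wedge (opJ v X l) (opJ v Y l)
        + wedge (opJ v X (-l)) (opJ v Y (-l))) atTop (𝓝 0) :=
      (wedgeField (opJ v X) (opJ v Y)).tendsto_add_neg
    have h3 := tendsto_antideriv_add_antideriv_neg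
      (wedgeField (opR v X) (SchwartzMap.derivCLM ℝ _ Y))
    have h4 := tendsto_antideriv_add_antideriv_neg
      (wedgeField (opR v Y) (SchwartzMap.derivCLM ℝ _ X))
    have h := ((h1.sub h2).add h3).sub h4
    simp only [ContinuousLinearMap.comp_zero, sub_zero, add_zero] at h
    refine h.congr fun l => ?_
    simp only [Function.comp_apply]
    abel

/-- Write `ℜX = D_X(JX) + Av` and `ℜY = D_X(JY) + Bv`. The terms `B(ℜX) - A(ℜY)` of the left side
supply `(BA - AB)v`, which the right side obtains from the commutator; the remaining local terms
cancel through `(v ∧ JY)JX - (v ∧ JX)JY = (JX ∧ JY)v`. -/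
theorem derivR_torsion {v X Y : SField k}
    (hX : ∫ l, wedgeField v (opJ v X) l = 0) (hY : ∫ l, wedgeField v (opJ v Y) l = 0) :
    derivR v (opR v X) Y - derivR v (opR v Y) X = opR v (derivR v X Y - derivR v Y X) := by
  ext1 l
  have e : ⇑(opJ v (derivR v X Y - derivR v Y X)) = fun s =>
      derivJ v (opR v X) Y s - derivJ v (opR v Y) X s
        + antideriv (wedgeField v (opJ v Y)) s (opJ v X s)
        - antideriv (wedgeField v (opJ v X)) s (opJ v Y s) :=
    funext fun s => opJ_derivR_sub_apply v X Y s
  have hd := (((((derivJ v (opR v X) Y).hasDerivAt l).fun_sub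
    ((derivJ v (opR v Y) X).hasDerivAt l)).fun_add
    ((hasDerivAt_antideriv (wedgeField v (opJ v Y)) l).clm_apply ((opJ v X).hasDerivAt l))).fun_sub
    ((hasDerivAt_antideriv (wedgeField v (opJ v X)) l).clm_apply ((opJ v Y).hasDerivAt l))).deriv
  rw [← e] at hd
  rw [opR_apply, hd, antideriv_wedgeField_opJ_derivR_sub hX hY, sub_apply, derivR_apply,
    derivR_apply]
  simp only [opR_apply, wedgeField_eq, wedge_apply, sub_apply, add_apply, map_add,
    ContinuousLinearMap.comp_apply]
  rw [real_inner_comm (v l) (opJ v X l), real_inner_comm (v l) (opJ v Y l),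
    real_inner_comm (opJ v X l) (opJ v Y l)]
  module

theorem isHereditaryOperator_dR {p q : ℕ} :
    IsHereditaryOperator (fun v : DField p q => {X | dJ v X ∈ dDomH v}) dR := by
  refine ⟨fun v => ⟨fun X Y => ?_, fun t X => ?_⟩,
    fun v W X => (derivR v.1 W.1 X.1, derivR v.2 W.2 X.2),
    IsOperatorDeriv.prodMk hasDirDeriv_opR hasDirDeriv_opR, fun v X hX Y hY =>
    Prod.ext (derivR_torsion hX.1 hY.1) (derivR_torsion hX.2 hY.2)⟩
  · exact Prod.ext (by simp only [dR, opR, Prod.fst_add, opJ_add, opH_add])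
      (by simp only [dR, opR, Prod.snd_add, opJ_add, opH_add])
  · exact Prod.ext (by simp only [dR, opR, Prod.smul_fst, opJ_smul, opH_smul])
      (by simp only [dR, opR, Prod.smul_snd, opJ_smul, opH_smul])

end Hereditary

/-! ### Calculus of smooth functions of two variables -/

section TwoVariables

variable {E F : Type*} [NormedAddCommGroup E] [NormedSpace ℝ E]
  [NormedAddCommGroup F] [NormedSpace ℝ F]

/-- The partial derivative in the second variable `l`. -/
noncomputable def derivL (f : ℝ → ℝ → E) (τ l : ℝ) : E := deriv (fun s => f τ s) l

/-- The partial derivative in the first variable `τ`. -/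
noncomputable def derivT (f : ℝ → ℝ → E) (τ l : ℝ) : E := deriv (fun s => f s l) τ

/-- Smoothness of a function of `(τ, l)` on a set. -/
def SmoothOn₂ (W : Set (ℝ × ℝ)) (f : ℝ → ℝ → E) : Prop :=
  ContDiffOn ℝ ∞ (fun z : ℝ × ℝ => f z.1 z.2) W

variable {W : Set (ℝ × ℝ)} {f : ℝ → ℝ → E} {τ l : ℝ}

theorem eventually_mem_right (hW : IsOpen W) (hz : (τ, l) ∈ W) : ∀ᶠ s in 𝓝 l, (τ, s) ∈ W :=
  (Continuous.prodMk_right τ).continuousAt.eventually_mem (hW.mem_nhds hz)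

theorem eventually_mem_left (hW : IsOpen W) (hz : (τ, l) ∈ W) : ∀ᶠ s in 𝓝 τ, (s, l) ∈ W :=
  (Continuous.prodMk_left l).continuousAt.eventually_mem (hW.mem_nhds hz)

theorem HasFDerivAt.hasDerivAt_prod_right {G : ℝ × ℝ → E} {G' : ℝ × ℝ →L[ℝ] E}
    (h : HasFDerivAt G G' (τ, l)) : HasDerivAt (fun s => G (τ, s)) (G' (0, 1)) l :=
  h.comp_hasDerivAt (f := fun s => (τ, s)) l ((hasDerivAt_const l τ).prodMk (hasDerivAt_id' l))

theorem HasFDerivAt.hasDerivAt_prod_left {G : ℝ × ℝ → E} {G' : ℝ × ℝ →L[ℝ] E}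
    (h : HasFDerivAt G G' (τ, l)) : HasDerivAt (fun s => G (s, l)) (G' (1, 0)) τ :=
  h.comp_hasDerivAt (f := fun s => (s, l)) τ ((hasDerivAt_id' τ).prodMk (hasDerivAt_const τ l))

theorem SmoothOn₂.hasFDerivAt (h : SmoothOn₂ W f) (hW : IsOpen W) (hz : (τ, l) ∈ W) :
    HasFDerivAt (fun z : ℝ × ℝ => f z.1 z.2)
      (fderiv ℝ (fun z : ℝ × ℝ => f z.1 z.2) (τ, l)) (τ, l) :=
  ((h.contDiffAt (hW.mem_nhds hz)).differentiableAt (by simp)).hasFDerivAt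

theorem SmoothOn₂.hasDerivAt_right_fderiv (h : SmoothOn₂ W f) (hW : IsOpen W) (hz : (τ, l) ∈ W) :
    HasDerivAt (fun s => f τ s) (fderiv ℝ (fun z : ℝ × ℝ => f z.1 z.2) (τ, l) (0, 1)) l :=
  (h.hasFDerivAt hW hz).hasDerivAt_prod_right

theorem SmoothOn₂.hasDerivAt_left_fderiv (h : SmoothOn₂ W f) (hW : IsOpen W) (hz : (τ, l) ∈ W) :
    HasDerivAt (fun s => f s l) (fderiv ℝ (fun z : ℝ × ℝ => f z.1 z.2) (τ, l) (1, 0)) τ :=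
  (h.hasFDerivAt hW hz).hasDerivAt_prod_left

theorem SmoothOn₂.hasDerivAt_right (h : SmoothOn₂ W f) (hW : IsOpen W) (hz : (τ, l) ∈ W) :
    HasDerivAt (fun s => f τ s) (derivL f τ l) l :=
  (h.hasDerivAt_right_fderiv hW hz).differentiableAt.hasDerivAt

theorem SmoothOn₂.hasDerivAt_left (h : SmoothOn₂ W f) (hW : IsOpen W) (hz : (τ, l) ∈ W) :
    HasDerivAt (fun s => f s l) (derivT f τ l) τ :=
  (h.hasDerivAt_left_fderiv hW hz).differentiableAt.hasDerivAt

theorem SmoothOn₂.derivL (h : SmoothOn₂ W f) (hW : IsOpen W) : SmoothOn₂ W (derivL f) :=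
  ((ContDiffOn.fderiv_of_isOpen h hW (m := ∞) (by simp)).clm_apply
    (contDiffOn_const (c := ((0, 1) : ℝ × ℝ)))).congr fun _ hz =>
      (h.hasDerivAt_right_fderiv hW hz).deriv

theorem SmoothOn₂.derivT (h : SmoothOn₂ W f) (hW : IsOpen W) : SmoothOn₂ W (derivT f) :=
  ((ContDiffOn.fderiv_of_isOpen h hW (m := ∞) (by simp)).clm_apply
    (contDiffOn_const (c := ((1, 0) : ℝ × ℝ)))).congr fun _ hz =>
      (h.hasDerivAt_left_fderiv hW hz).deriv

theorem SmoothOn₂.derivL_derivT (h : SmoothOn₂ W f) (hW : IsOpen W) (hz : (τ, l) ∈ W) :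
    _root_.derivL (_root_.derivT f) τ l = _root_.derivT (_root_.derivL f) τ l := by
  have h2 : HasFDerivAt (fderiv ℝ fun z : ℝ × ℝ => f z.1 z.2)
      (fderiv ℝ (fderiv ℝ fun z : ℝ × ℝ => f z.1 z.2) (τ, l)) (τ, l) :=
    (((ContDiffOn.fderiv_of_isOpen h hW (m := ∞) (by simp)).contDiffAt
      (hW.mem_nhds hz)).differentiableAt (by simp)).hasFDerivAt
  have hL : HasDerivAt (fun s => _root_.derivT f τ s)
      (fderiv ℝ (fderiv ℝ fun z : ℝ × ℝ => f z.1 z.2) (τ, l) (0, 1) (1, 0)) l := by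
    have h3 := h2.hasDerivAt_prod_right.clm_apply (hasDerivAt_const l ((1, 0) : ℝ × ℝ))
    rw [map_zero, add_zero] at h3
    refine h3.congr_of_eventuallyEq ?_
    filter_upwards [eventually_mem_right hW hz] with s hs
    exact (h.hasDerivAt_left_fderiv hW hs).deriv
  have hT : HasDerivAt (fun s => _root_.derivL f s l)
      (fderiv ℝ (fderiv ℝ fun z : ℝ × ℝ => f z.1 z.2) (τ, l) (1, 0) (0, 1)) τ := by
    have h3 := h2.hasDerivAt_prod_left.clm_apply (hasDerivAt_const τ ((0, 1) : ℝ × ℝ))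
    rw [map_zero, add_zero] at h3
    refine h3.congr_of_eventuallyEq ?_
    filter_upwards [eventually_mem_left hW hz] with s hs
    exact (h.hasDerivAt_right_fderiv hW hs).deriv
  have hsymm : IsSymmSndFDerivAt ℝ (fun z : ℝ × ℝ => f z.1 z.2) (τ, l) :=
    (ContDiffOn.contDiffAt h (hW.mem_nhds hz)).isSymmSndFDerivAt
      (by simp only [minSmoothness_of_isRCLikeNormedField]; exact ENat.LEInfty.out)
  exact hL.deriv.trans ((hsymm (0, 1) (1, 0)).trans hT.deriv.symm)

/-- By the chain rule both derivatives contain `A` applied to the mixed second derivative of `c`,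
and symmetry of that derivative cancels it. -/
theorem derivL_sub_derivT_clm_apply {U : Set F} (hU : IsOpen U) {A : F → F →L[ℝ] ℝ}
    (hA : ContDiffOn ℝ ∞ A U) {c : ℝ → ℝ → F} (hW : IsOpen W) (hc : SmoothOn₂ W c)
    (hcU : ∀ τ l, (τ, l) ∈ W → c τ l ∈ U) (hz : (τ, l) ∈ W) :
    derivL (fun τ l => A (c τ l) (derivT c τ l)) τ l
        - derivT (fun τ l => A (c τ l) (derivL c τ l)) τ l
      = fderiv ℝ A (c τ l) (derivL c τ l) (derivT c τ l)
        - fderiv ℝ A (c τ l) (derivT c τ l) (derivL c τ l) := by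
  have hA' : HasFDerivAt A (fderiv ℝ A (c τ l)) (c τ l) :=
    ((hA.contDiffAt (hU.mem_nhds (hcU τ l hz))).differentiableAt (by simp)).hasFDerivAt
  have hL : HasDerivAt (fun s => A (c τ s) (derivT c τ s)) _ l :=
    (hA'.comp_hasDerivAt (f := fun s => c τ s) l (hc.hasDerivAt_right hW hz)).clm_apply
      ((hc.derivT hW).hasDerivAt_right hW hz)
  have hT : HasDerivAt (fun s => A (c s l) (derivL c s l)) _ τ :=
    (hA'.comp_hasDerivAt (f := fun s => c s l) τ (hc.hasDerivAt_left hW hz)).clm_apply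
      ((hc.derivL hW).hasDerivAt_left hW hz)
  have eL := hL.deriv
  have eT := hT.deriv
  rw [hc.derivL_derivT hW hz] at eL
  simp only [derivL, derivT] at eL eT ⊢
  rw [eL, eT]
  simp only [Function.comp_apply]
  abel

/-- The exterior derivative commutes with the pull-back of a 1-form along a map of the plane. -/
theorem derivL_sub_derivT_pullback [FiniteDimensional ℝ F] {U : Set F} (hU : IsOpen U)
    {α : F → F → ℝ} (hlin : ∀ u, IsLinearMap ℝ (α u))
    (hα : ∀ ξ, ContDiffOn ℝ ∞ (fun u => α u ξ) U) {c : ℝ → ℝ → F} (hW : IsOpen W)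
    (hc : SmoothOn₂ W c) (hcU : ∀ τ l, (τ, l) ∈ W → c τ l ∈ U) :
    SmoothOn₂ W (fun τ l => α (c τ l) (derivL c τ l)) ∧
    SmoothOn₂ W (fun τ l => α (c τ l) (derivT c τ l)) ∧
    ∀ τ l, (τ, l) ∈ W →
      derivL (fun τ l => α (c τ l) (derivT c τ l)) τ l
        - derivT (fun τ l => α (c τ l) (derivL c τ l)) τ l
      = fderiv ℝ (fun w => α w (derivT c τ l)) (c τ l) (derivL c τ l)
        - fderiv ℝ (fun w => α w (derivL c τ l)) (c τ l) (derivT c τ l) := by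
  -- In finite dimension the form is a field of continuous functionals, smooth as soon as its values
  -- on each fixed vector are.
  obtain ⟨A, rfl⟩ : ∃ A : F → F →L[ℝ] ℝ, α = fun u ξ => A u ξ :=
    ⟨fun u => LinearMap.toContinuousLinearMap ((hlin u).mk' _), rfl⟩
  have hA : ContDiffOn ℝ ∞ A U := contDiffOn_clm_apply.2 hα
  have hAc : SmoothOn₂ W (fun τ l => A (c τ l)) := hA.comp hc fun z hz => hcU z.1 z.2 hz
  refine ⟨hAc.clm_apply (hc.derivL hW), hAc.clm_apply (hc.derivT hW), fun τ l hz => ?_⟩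
  have hA' : DifferentiableAt ℝ A (c τ l) :=
    (hA.contDiffAt (hU.mem_nhds (hcU τ l hz))).differentiableAt (by simp)
  have hd : ∀ ξ η, fderiv ℝ (fun w => A w ξ) (c τ l) η = fderiv ℝ A (c τ l) η ξ := fun ξ η => by
    rw [fderiv_clm_apply hA' (differentiableAt_const ξ)]
    simp
  rw [derivL_sub_derivT_clm_apply hU hA hW hc hcU hz, hd, hd]

end TwoVariables

/-! ### Matrix-valued functions of two variables -/

section MatrixCalculus

variable {W : Set (ℝ × ℝ)} {τ l : ℝ} {ι κ ν : Type*} 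

/-- Smoothness of the entries of a matrix-valued function of `(τ, l)`. -/
def MSmoothOn (W : Set (ℝ × ℝ)) (M : ℝ → ℝ → Matrix ι κ ℝ) : Prop :=
  ∀ i j, SmoothOn₂ W (fun τ l => M τ l i j)

/-- The entrywise partial derivative in `l`. -/
noncomputable def mderivL (M : ℝ → ℝ → Matrix ι κ ℝ) (τ l : ℝ) : Matrix ι κ ℝ :=
  Matrix.of fun i j => derivL (fun τ l => M τ l i j) τ l

/-- The entrywise partial derivative in `τ`. -/
noncomputable def mderivT (M : ℝ → ℝ → Matrix ι κ ℝ) (τ l : ℝ) : Matrix ι κ ℝ :=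
  Matrix.of fun i j => derivT (fun τ l => M τ l i j) τ l

theorem MSmoothOn.mderivL {M : ℝ → ℝ → Matrix ι κ ℝ} (hM : MSmoothOn W M) (hW : IsOpen W) :
    MSmoothOn W (mderivL M) := fun i j => (hM i j).derivL hW

theorem MSmoothOn.mderivT {M : ℝ → ℝ → Matrix ι κ ℝ} (hM : MSmoothOn W M) (hW : IsOpen W) :
    MSmoothOn W (mderivT M) := fun i j => (hM i j).derivT hW

variable [Fintype κ]

theorem MSmoothOn.mul {M : ℝ → ℝ → Matrix ι κ ℝ} {P : ℝ → ℝ → Matrix κ ν ℝ}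
    (hM : MSmoothOn W M) (hP : ∀ i j, SmoothOn₂ W (fun τ l => P τ l i j)) (i : ι) (j : ν) :
    SmoothOn₂ W (fun τ l => (M τ l * P τ l) i j) := by
  simp only [Matrix.mul_apply]
  exact ContDiffOn.sum fun r _ => (hM i r).mul (hP r j)

theorem hasDerivAt_matrix_mul_apply {M : ℝ → Matrix ι κ ℝ} {P : ℝ → Matrix κ ν ℝ}
    {M' : Matrix ι κ ℝ} {P' : Matrix κ ν ℝ} {t : ℝ}
    (hM : ∀ i j, HasDerivAt (fun s => M s i j) (M' i j) t)
    (hP : ∀ i j, HasDerivAt (fun s => P s i j) (P' i j) t) (i : ι) (j : ν) :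
    HasDerivAt (fun s => (M s * P s) i j) ((M' * P t + M t * P') i j) t := by
  simp only [Matrix.mul_apply, Matrix.add_apply, ← Finset.sum_add_distrib]
  exact HasDerivAt.fun_sum fun r _ => (hM i r).fun_mul (hP r j)

/-- The structure equation of curvature in a moving frame `E`. -/
theorem curvature_in_frame {E a b Λ Ω : ℝ → ℝ → Matrix κ κ ℝ} (hW : IsOpen W)
    (hE : MSmoothOn W E) (ha : MSmoothOn W a) (hb : MSmoothOn W b) (hΛ : MSmoothOn W Λ)
    (hΩ : MSmoothOn W Ω)
    (hL : ∀ τ l, (τ, l) ∈ W → mderivL E τ l + a τ l * E τ l = E τ l * Λ τ l)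
    (hT : ∀ τ l, (τ, l) ∈ W → mderivT E τ l + b τ l * E τ l = E τ l * Ω τ l)
    (hz : (τ, l) ∈ W) :
    (mderivL b τ l - mderivT a τ l + (a τ l * b τ l - b τ l * a τ l)) * E τ l
      = E τ l * (mderivL Ω τ l - mderivT Λ τ l + (Λ τ l * Ω τ l - Ω τ l * Λ τ l)) := by
  -- The frame equations are solved for the first derivatives of `E` and differentiated once more;
  -- equating the two mixed derivatives gives the structure equation.
  have h1 : mderivT (mderivL E) τ l = mderivT E τ l * Λ τ l + E τ l * mderivT Λ τ l
      - (mderivT a τ l * E τ l + a τ l * mderivT E τ l) := by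
    ext i j
    have h := (hasDerivAt_matrix_mul_apply (M := fun s => E s l) (P := fun s => Λ s l)
      (fun i j => (hE i j).hasDerivAt_left hW hz)
      (fun i j => (hΛ i j).hasDerivAt_left hW hz) i j).fun_sub
      (hasDerivAt_matrix_mul_apply (M := fun s => a s l) (P := fun s => E s l)
        (fun i j => (ha i j).hasDerivAt_left hW hz)
        (fun i j => (hE i j).hasDerivAt_left hW hz) i j)
    refine (h.congr_of_eventuallyEq ?_).deriv
    filter_upwards [eventually_mem_left hW hz] with s hs
    rw [← Matrix.sub_apply, ← hL s l hs, add_sub_cancel_right]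
  have h2 : mderivL (mderivT E) τ l = mderivL E τ l * Ω τ l + E τ l * mderivL Ω τ l
      - (mderivL b τ l * E τ l + b τ l * mderivL E τ l) := by
    ext i j
    have h := (hasDerivAt_matrix_mul_apply (M := fun s => E τ s) (P := fun s => Ω τ s)
      (fun i j => (hE i j).hasDerivAt_right hW hz)
      (fun i j => (hΩ i j).hasDerivAt_right hW hz) i j).fun_sub
      (hasDerivAt_matrix_mul_apply (M := fun s => b τ s) (P := fun s => E τ s)
        (fun i j => (hb i j).hasDerivAt_right hW hz)
        (fun i j => (hE i j).hasDerivAt_right hW hz) i j)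
    refine (h.congr_of_eventuallyEq ?_).deriv
    filter_upwards [eventually_mem_right hW hz] with s hs
    rw [← Matrix.sub_apply, ← hT τ s hs, add_sub_cancel_right]
  have h3 : mderivL (mderivT E) τ l = mderivT (mderivL E) τ l := by
    ext i j
    exact (hE i j).derivL_derivT hW hz
  have eL : mderivL E τ l = E τ l * Λ τ l - a τ l * E τ l := by rw [← hL τ l hz]; abel
  have eT : mderivT E τ l = E τ l * Ω τ l - b τ l * E τ l := by rw [← hT τ l hz]; abel
  rw [h1, h2, eL, eT] at h3
  simp only [sub_mul, mul_sub, add_mul, mul_add, mul_assoc] at h3 ⊢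
  rw [← sub_eq_zero] at h3 ⊢
  rw [← neg_eq_zero, ← h3]
  abel

/-- The structure equation of torsion in a moving frame `E`. -/
theorem torsion_in_frame {E a b Λ Ω : ℝ → ℝ → Matrix κ κ ℝ} {ν : Type*}
    {y p x q : ℝ → ℝ → Matrix κ ν ℝ} [Fintype ν] (hW : IsOpen W)
    (hE : MSmoothOn W E) (hp : MSmoothOn W p) (hq : MSmoothOn W q)
    (hL : ∀ τ l, (τ, l) ∈ W → mderivL E τ l + a τ l * E τ l = E τ l * Λ τ l)
    (hT : ∀ τ l, (τ, l) ∈ W → mderivT E τ l + b τ l * E τ l = E τ l * Ω τ l)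
    (hy : ∀ τ l, (τ, l) ∈ W → y τ l = E τ l * p τ l)
    (hx : ∀ τ l, (τ, l) ∈ W → x τ l = E τ l * q τ l)
    (hz : (τ, l) ∈ W) :
    mderivL y τ l + a τ l * y τ l - (mderivT x τ l + b τ l * x τ l)
      = E τ l * (mderivL p τ l + Λ τ l * p τ l - (mderivT q τ l + Ω τ l * q τ l)) := by
  have h1 : mderivL y τ l = mderivL E τ l * p τ l + E τ l * mderivL p τ l := by
    ext i j
    refine ((hasDerivAt_matrix_mul_apply (M := fun s => E τ s) (P := fun s => p τ s)
      (fun i j => (hE i j).hasDerivAt_right hW hz)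
      (fun i j => (hp i j).hasDerivAt_right hW hz) i j).congr_of_eventuallyEq ?_).deriv
    filter_upwards [eventually_mem_right hW hz] with s hs
    rw [hy τ s hs]
  have h2 : mderivT x τ l = mderivT E τ l * q τ l + E τ l * mderivT q τ l := by
    ext i j
    refine ((hasDerivAt_matrix_mul_apply (M := fun s => E s l) (P := fun s => q s l)
      (fun i j => (hE i j).hasDerivAt_left hW hz)
      (fun i j => (hq i j).hasDerivAt_left hW hz) i j).congr_of_eventuallyEq ?_).deriv
    filter_upwards [eventually_mem_left hW hz] with s hs
    rw [hx s l hs]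
  have eL : mderivL E τ l = E τ l * Λ τ l - a τ l * E τ l := by rw [← hL τ l hz]; abel
  have eT : mderivT E τ l = E τ l * Ω τ l - b τ l * E τ l := by rw [← hT τ l hz]; abel
  rw [h1, h2, eL, eT, hy τ l hz, hx τ l hz]
  simp only [Matrix.mul_add, Matrix.mul_sub, Matrix.sub_mul, Matrix.mul_assoc]
  abel

end MatrixCalculus

/-! ### The structure equations of a curve flow -/

section StructureEquations

variable {n m : ℕ}

/-- A block whose coframe, connection and metric are smooth on an open set `U` of coordinates. -/
structure DBlock.IsSmoothOn {k : ℕ} (B : DBlock n m k) (U : Set (Coord n m)) : Prop where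
  linear_θ : ∀ u i, IsLinearMap ℝ (fun ξ => B.θ u ξ i)
  linear_conn : ∀ u i j, IsLinearMap ℝ (fun ξ => B.conn u ξ i j)
  smooth_θ : ∀ ξ i, ContDiffOn ℝ ∞ (fun u => B.θ u ξ i) U
  smooth_conn : ∀ ξ i j, ContDiffOn ℝ ∞ (fun u => B.conn u ξ i j) U
  smooth_met : ∀ i j, ContDiffOn ℝ ∞ (fun u => B.met u i j) U

/-- The matrix of the connection in a parallel frame, with principal normal `w` and rotation `T`. -/
def frameConn {r : ℕ} (w : Fin r → ℝ) (T : Matrix (Fin r) (Fin r) ℝ) :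
    Matrix (Fin (r + 1)) (Fin (r + 1)) ℝ :=
  Matrix.of fun i j => Fin.cases (Fin.cases 0 (fun j' => -w j') j)
    (fun i' => Fin.cases (w i') (fun j' => T j' i') j) i

section FrameConn

variable {r : ℕ} (w : Fin r → ℝ) (T : Matrix (Fin r) (Fin r) ℝ) (i j : Fin r)

@[simp] theorem frameConn_zero_zero : frameConn w T 0 0 = 0 := rfl
@[simp] theorem frameConn_zero_succ : frameConn w T 0 j.succ = -w j := rfl
@[simp] theorem frameConn_succ_zero : frameConn w T i.succ 0 = w i := rfl
@[simp] theorem frameConn_succ_succ : frameConn w T i.succ j.succ = T j i := rfl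

end FrameConn

/-- The column `(a, w)`. -/
def frameCol {r : ℕ} (a : ℝ) (w : Fin r → ℝ) : Matrix (Fin (r + 1)) Unit ℝ :=
  Matrix.of fun i _ => Fin.cases a w i

@[simp] theorem frameCol_zero {r : ℕ} (a : ℝ) (w : Fin r → ℝ) (t : Unit) :
    frameCol a w 0 t = a := rfl

@[simp] theorem frameCol_succ {r : ℕ} (a : ℝ) (w : Fin r → ℝ) (i : Fin r) (t : Unit) :
    frameCol a w i.succ t = w i := rfl

variable {V : Type*} [TopologicalSpace V] [ChartedSpace (Coord n m) V] {r : ℕ}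
  {B : LChart n m V → DBlock n m (r + 1)} {R : ℝ} {I : Set ℝ} {γ : ℝ → ℝ → V}
  {e : LChart n m V → Fin (r + 1) → ℝ → ℝ → Fin (r + 1) → ℝ} {v perp : ℝ → SField r}
  {ϖ : ℝ → ℝ → Vec r} {par : ℝ → ℝ → ℝ} {Θ : ℝ → ℝ → Matrix (Fin r) (Fin r) ℝ}

/-- Expressed in the frame, vanishing torsion is a column identity and constant curvature a matrix
identity. Their tangential and normal entries are the four conclusions. The derivative `d` of `ϖ`
stays unnamed until `ϖ` is known to be `J(e_⊥)`. -/
theorem IsCurveFlow.structure_equations (h : IsCurveFlow B R I γ e v perp ϖ par Θ)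
    {φ : LChart n m V} (hφ : φ ∈ atlas (Coord n m) V) (hB : (B φ).IsSmoothOn φ.target)
    {W : Set (ℝ × ℝ)} (hWdef : W = {z | z.1 ∈ I ∧ γ z.1 z.2 ∈ φ.source}) (hW : IsOpen W)
    (hc : SmoothOn₂ W (fun τ l => φ (γ τ l))) {τ l : ℝ} (hz : (τ, l) ∈ W) :
    HasDerivAt (par τ) (∑ j, v τ l j * perp τ l j) l ∧
    (∀ j, ϖ τ l j = deriv (perp τ) l j + par τ l * v τ l j) ∧
    (∀ i j, HasDerivAt (fun s => Θ τ s i j) (ϖ τ l i * v τ l j - v τ l i * ϖ τ l j) l) ∧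
    ∀ j, ∃ d, HasDerivAt (fun s => ϖ τ s j) d l ∧
      HasDerivAt (fun s => v s l j) (d - ∑ i, v τ l i * Θ τ l i j - R * perp τ l j) τ := by
  have hmem : ∀ {τ l}, (τ, l) ∈ W → τ ∈ I ∧ γ τ l ∈ φ.source := fun hz => by rwa [hWdef] at hz
  set c : ℝ → ℝ → Coord n m := fun τ l => φ (γ τ l)
  have hcU : ∀ τ l, (τ, l) ∈ W → c τ l ∈ φ.target := fun τ l hz => φ.map_source (hmem hz).2
  let E : ℝ → ℝ → Matrix (Fin (r + 1)) (Fin (r + 1)) ℝ := fun τ l => Matrix.of fun i j => e φ j τ l i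
  let G : ℝ → ℝ → Matrix (Fin (r + 1)) (Fin (r + 1)) ℝ := fun τ l => (B φ).met (c τ l)
  let a : ℝ → ℝ → Matrix (Fin (r + 1)) (Fin (r + 1)) ℝ := fun τ l =>
    (B φ).conn (c τ l) (derivL c τ l)
  let b : ℝ → ℝ → Matrix (Fin (r + 1)) (Fin (r + 1)) ℝ := fun τ l =>
    (B φ).conn (c τ l) (derivT c τ l)
  let Λ : ℝ → ℝ → Matrix (Fin (r + 1)) (Fin (r + 1)) ℝ := fun τ l => frameConn (v τ l) 0
  let Ω : ℝ → ℝ → Matrix (Fin (r + 1)) (Fin (r + 1)) ℝ := fun τ l => frameConn (ϖ τ l) (Θ τ l)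
  let x : ℝ → ℝ → Matrix (Fin (r + 1)) Unit ℝ := fun τ l =>
    Matrix.of fun i _ => (B φ).θ (c τ l) (derivL c τ l) i
  let y : ℝ → ℝ → Matrix (Fin (r + 1)) Unit ℝ := fun τ l =>
    Matrix.of fun i _ => (B φ).θ (c τ l) (derivT c τ l) i
  let q : ℝ → ℝ → Matrix (Fin (r + 1)) Unit ℝ := fun _ _ => frameCol 1 0
  let p : ℝ → ℝ → Matrix (Fin (r + 1)) Unit ℝ := fun τ l => frameCol (par τ l) (perp τ l)
  -- the forms of the block along the flow
  have hconn := fun i j => derivL_sub_derivT_pullback φ.open_target (hB.linear_conn · i j)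
    (hB.smooth_conn · i j) hW hc hcU
  have hθ := fun i => derivL_sub_derivT_pullback φ.open_target (hB.linear_θ · i)
    (hB.smooth_θ · i) hW hc hcU
  have ha : MSmoothOn W a := fun i j => (hconn i j).1
  have hb : MSmoothOn W b := fun i j => (hconn i j).2.1
  have hsy : MSmoothOn W y := fun i _ => (hθ i).2.1
  have hG : MSmoothOn W G := fun i j =>
    (hB.smooth_met i j).comp hc fun z hz => hcU z.1 z.2 hz
  have he : ∀ i, SmoothOn₂ W (e φ i) := fun i => by
    have := h.frame.smooth φ hφ i
    rwa [← hWdef] at this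
  have hE : MSmoothOn W E := fun i j => contDiffOn_pi.1 (he j) i
  -- the frame is orthonormal, hence invertible
  have hinv : ∀ τ l, (τ, l) ∈ W → ((E τ l).transpose * G τ l) * E τ l = 1 := fun τ l hz => by
    ext i j
    have := h.frame.orthonormal φ hφ τ (hmem hz).1 l (hmem hz).2 i j
    rw [Matrix.one_apply, ← this, Matrix.mul_assoc, Matrix.mul_apply]
    rfl
  have hE' : MSmoothOn W fun τ l => (E τ l).transpose * G τ l :=
    MSmoothOn.mul (fun i j => hE j i) hG
  -- Joint smoothness of `v`, `ϖ`, `Θ` and `e_∥` is not part of the flow data: it follows by solving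
  -- for frame components with the smooth left inverse `EᵀG`.
  have hsolve : ∀ {κ : Type} (M P : ℝ → ℝ → Matrix (Fin (r + 1)) κ ℝ), MSmoothOn W P →
      (∀ τ l, (τ, l) ∈ W → P τ l = E τ l * M τ l) → MSmoothOn W M := fun M P hP hM i j =>
    (MSmoothOn.mul hE' hP i j).congr fun z hz => by
      change M z.1 z.2 i j = ((E z.1 z.2).transpose * G z.1 z.2 * P z.1 z.2) i j
      rw [hM z.1 z.2 hz, ← Matrix.mul_assoc, hinv z.1 z.2 hz, Matrix.one_mul]
  -- the frame equations in matrix form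
  have hL : ∀ τ l, (τ, l) ∈ W → mderivL E τ l + a τ l * E τ l = E τ l * Λ τ l := by
    intro τ l hz
    ext i j
    have h0 : (mderivL E τ l + a τ l * E τ l) i j = covL (B φ) φ γ (e φ j) τ l i :=
      congrArg₂ (· + ·) (hasDerivAt_pi.1 ((he j).hasDerivAt_right hW hz) i).deriv rfl
    rw [h0, Matrix.mul_apply, Fin.sum_univ_succ]
    induction j using Fin.cases with
    | zero =>
      rw [h.covL_zero φ hφ τ (hmem hz).1 l (hmem hz).2]
      simp [Λ, E, mul_comm]
    | succ j =>
      rw [h.covL_succ φ hφ τ (hmem hz).1 l (hmem hz).2]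
      simp [Λ, E, mul_comm]
  have hT : ∀ τ l, (τ, l) ∈ W → mderivT E τ l + b τ l * E τ l = E τ l * Ω τ l := by
    intro τ l hz
    ext i j
    have h0 : (mderivT E τ l + b τ l * E τ l) i j = covT (B φ) φ γ (e φ j) τ l i :=
      congrArg₂ (· + ·) (hasDerivAt_pi.1 ((he j).hasDerivAt_left hW hz) i).deriv rfl
    rw [h0, Matrix.mul_apply, Fin.sum_univ_succ]
    induction j using Fin.cases with
    | zero =>
      rw [h.covT_zero φ hφ τ (hmem hz).1 l (hmem hz).2]
      simp [Ω, E, mul_comm]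
    | succ j =>
      rw [h.covT_succ φ hφ τ (hmem hz).1 l (hmem hz).2]
      simp [Ω, E, mul_comm]
  have hx : ∀ τ l, (τ, l) ∈ W → x τ l = E τ l * q τ l := by
    intro τ l hz
    ext i j
    rw [Matrix.mul_apply, Fin.sum_univ_succ]
    refine (congrFun (h.tangent φ hφ τ (hmem hz).1 l (hmem hz).2) i).trans ?_
    simp [q, E]
  have hy : ∀ τ l, (τ, l) ∈ W → y τ l = E τ l * p τ l := by
    intro τ l hz
    ext i j
    rw [Matrix.mul_apply, Fin.sum_univ_succ]
    refine (congrFun (h.flow φ hφ τ (hmem hz).1 l (hmem hz).2) i).trans ?_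
    simp [p, E, mul_comm]
  have hΛ : MSmoothOn W Λ := hsolve Λ (fun τ l => mderivL E τ l + a τ l * E τ l)
    (fun i j => (hE.mderivL hW i j).add (ha.mul hE i j)) hL
  have hΩ : MSmoothOn W Ω := hsolve Ω (fun τ l => mderivT E τ l + b τ l * E τ l)
    (fun i j => (hE.mderivT hW i j).add (hb.mul hE i j)) hT
  have hp : MSmoothOn W p := hsolve p y hsy hy
  have hq : MSmoothOn W q := fun i j => contDiffOn_const
  have hcancel : ∀ {κ : Type} {M P : Matrix (Fin (r + 1)) κ ℝ}, E τ l * M = E τ l * P → M = P :=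
    fun {κ M P} hMP => by
      rw [← Matrix.one_mul M, ← Matrix.one_mul P, ← hinv τ l hz, Matrix.mul_assoc, hMP,
        ← Matrix.mul_assoc]
  -- torsion
  have htor : mderivL p τ l + Λ τ l * p τ l = mderivT q τ l + Ω τ l * q τ l := by
    refine sub_eq_zero.1 (hcancel ?_)
    rw [← torsion_in_frame hW hE hp hq hL hT hy hx hz, Matrix.mul_zero]
    ext i j
    have h1 := congrFun (h.torsion_eq φ hφ τ (hmem hz).1 l (hmem hz).2) i
    have h2 := (hθ i).2.2 τ l hz
    simp only [DBlock.torsion, Pi.zero_apply] at h1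
    have h3 : mderivL y τ l i j - mderivT x τ l i j = _ := h2
    simp only [Matrix.sub_apply, Matrix.add_apply, Matrix.zero_apply]
    have h4 : (a τ l * y τ l) i j = ((B φ).conn (φ (γ τ l)) (velL φ γ τ l)).mulVec
      ((B φ).θ (φ (γ τ l)) (velT φ γ τ l)) i := rfl
    have h5 : (b τ l * x τ l) i j = ((B φ).conn (φ (γ τ l)) (velT φ γ τ l)).mulVec
      ((B φ).θ (φ (γ τ l)) (velL φ γ τ l)) i := rfl
    have h6 : derivL c τ l = velL φ γ τ l := rfl
    have h7 : derivT c τ l = velT φ γ τ l := rfl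
    have h8 : c τ l = φ (γ τ l) := rfl
    rw [h6, h7, h8] at h3
    rw [h4, h5]
    linarith
  -- curvature
  have hcurv : mderivL Ω τ l - mderivT Λ τ l + (Λ τ l * Ω τ l - Ω τ l * Λ τ l)
      = Matrix.of fun i j => R * (q τ l j () * p τ l i () - p τ l j () * q τ l i ()) := by
    refine hcancel ?_
    rw [← curvature_in_frame hW hE ha hb hΛ hΩ hL hT hz]
    have hF : mderivL b τ l - mderivT a τ l + (a τ l * b τ l - b τ l * a τ l)
        = (B φ).curvature (φ (γ τ l)) (velL φ γ τ l) (velT φ γ τ l) := by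
      ext i j
      exact congrArg (· + (a τ l * b τ l - b τ l * a τ l) i j) ((hconn i j).2.2 τ l hz)
    rw [hF]
    ext i j
    -- The curvature condition is applied to the frame vectors `Z = e_j`; orthonormality then reads
    -- off the components of `X` and `Y`.
    have h1 : ((B φ).curvature (φ (γ τ l)) (velL φ γ τ l) (velT φ γ τ l)).mulVec (e φ j τ l) i
        = R * ((B φ).ip (φ (γ τ l)) ((B φ).θ (φ (γ τ l)) (velL φ γ τ l)) (e φ j τ l)
            * y τ l i () - (B φ).ip (φ (γ τ l)) ((B φ).θ (φ (γ τ l)) (velT φ γ τ l)) (e φ j τ l)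
            * x τ l i ()) :=
      congrFun (h.curvature_eq φ hφ τ (hmem hz).1 l (hmem hz).2 (e φ j τ l)) i
    have horth : ∀ i, e φ i τ l ⬝ᵥ ((B φ).met (φ (γ τ l))).mulVec (e φ j τ l)
        = if i = j then 1 else 0 :=
      fun i => h.frame.orthonormal φ hφ τ (hmem hz).1 l (hmem hz).2 i j
    have hXj : (B φ).ip (φ (γ τ l)) ((B φ).θ (φ (γ τ l)) (velL φ γ τ l)) (e φ j τ l)
        = q τ l j () := by
      rw [h.tangent φ hφ τ (hmem hz).1 l (hmem hz).2, DBlock.ip, horth]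
      induction j using Fin.cases <;> simp [q, (Fin.succ_ne_zero _).symm]
    have hYj : (B φ).ip (φ (γ τ l)) ((B φ).θ (φ (γ τ l)) (velT φ γ τ l)) (e φ j τ l)
        = p τ l j () := by
      rw [h.flow φ hφ τ (hmem hz).1 l (hmem hz).2, DBlock.ip, add_dotProduct, smul_dotProduct,
        sum_dotProduct]
      simp only [smul_dotProduct, horth]
      induction j using Fin.cases <;> simp [p, Fin.succ_ne_zero, (Fin.succ_ne_zero _).symm]
    refine (show _ = _ from h1).trans ?_
    rw [hXj, hYj, hx τ l hz, hy τ l hz, Matrix.mul_apply, Matrix.mul_apply, Matrix.mul_apply,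
      Finset.mul_sum, Finset.mul_sum, ← Finset.sum_sub_distrib, Finset.mul_sum]
    refine Finset.sum_congr rfl fun k _ => ?_
    rw [Matrix.of_apply]
    ring
  -- The tangent vector has the constant components `(1, 0)` in the frame: the flow does not stretch
  -- the curves.
  have hq0 : mderivT q τ l = 0 := by
    ext i j
    exact deriv_const _ _
  rw [hq0, zero_add] at htor
  -- The tangential and normal rows of torsion, then the normal-normal and normal-tangential entries
  -- of curvature. The constant `R` drops out of the third, since `X` has no normal component.
  refine ⟨?_, fun j => ?_, fun i j => ?_, fun j => ⟨_, (hΩ j.succ 0).hasDerivAt_right hW hz, ?_⟩⟩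
  · have h0 : derivL (fun τ l => p τ l 0 ()) τ l + (Λ τ l * p τ l) 0 () = (Ω τ l * q τ l) 0 () :=
      congrFun (congrFun htor 0) ()
    refine ((hp 0 ()).hasDerivAt_right hW hz).congr_deriv ?_
    rw [Matrix.mul_apply, Matrix.mul_apply, Fin.sum_univ_succ, Fin.sum_univ_succ] at h0
    simp only [Λ, Ω, q, frameConn_zero_zero, frameConn_zero_succ, frameCol_zero, frameCol_succ,
      Pi.zero_apply, mul_zero, zero_mul, zero_add, Finset.sum_const_zero, neg_mul,
      Finset.sum_neg_distrib] at h0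
    exact add_neg_eq_zero.1 h0
  · have h0 : derivL (fun τ l => p τ l j.succ ()) τ l + (Λ τ l * p τ l) j.succ ()
        = (Ω τ l * q τ l) j.succ () := congrFun (congrFun htor j.succ) ()
    have h1 : derivL (fun τ l => p τ l j.succ ()) τ l = deriv (perp τ) l j :=
      ((EuclideanSpace.proj (𝕜 := ℝ) j).hasFDerivAt.comp_hasDerivAt l
        ((perp τ).hasDerivAt l)).deriv
    rw [Matrix.mul_apply, Matrix.mul_apply, Fin.sum_univ_succ, Fin.sum_univ_succ, h1] at h0
    simp only [Λ, Ω, p, q, frameConn_succ_zero, frameConn_succ_succ, frameCol_zero, frameCol_succ,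
      Pi.zero_apply, Matrix.zero_apply, mul_zero, zero_mul, mul_one, add_zero,
      Finset.sum_const_zero] at h0
    rw [← h0, mul_comm]
  · have h0 : derivL (fun τ l => Ω τ l j.succ i.succ) τ l
        - derivT (fun τ l => Λ τ l j.succ i.succ) τ l
        + ((Λ τ l * Ω τ l) j.succ i.succ - (Ω τ l * Λ τ l) j.succ i.succ)
        = R * (q τ l i.succ () * p τ l j.succ () - p τ l i.succ () * q τ l j.succ ()) :=
      congrFun (congrFun hcurv j.succ) i.succ
    have h1 : derivT (fun τ l => Λ τ l j.succ i.succ) τ l = 0 := deriv_const _ _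
    refine ((hΩ j.succ i.succ).hasDerivAt_right hW hz).congr_deriv ?_
    rw [Matrix.mul_apply, Matrix.mul_apply, Fin.sum_univ_succ, Fin.sum_univ_succ, h1] at h0
    simp only [Λ, Ω, q, frameConn_succ_zero, frameConn_succ_succ, frameConn_zero_succ,
      frameCol_succ, Pi.zero_apply, Matrix.zero_apply, mul_zero, zero_mul, add_zero, sub_zero,
      Finset.sum_const_zero] at h0
    simp only [Ω, frameConn_succ_succ]
    linear_combination h0
  · have h0 : derivL (fun τ l => Ω τ l j.succ 0) τ l - derivT (fun τ l => Λ τ l j.succ 0) τ l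
        + ((Λ τ l * Ω τ l) j.succ 0 - (Ω τ l * Λ τ l) j.succ 0)
        = R * (q τ l 0 () * p τ l j.succ () - p τ l 0 () * q τ l j.succ ()) :=
      congrFun (congrFun hcurv j.succ) 0
    refine ((hΛ j.succ 0).hasDerivAt_left hW hz).congr_deriv ?_
    rw [Matrix.mul_apply, Matrix.mul_apply, Fin.sum_univ_succ, Fin.sum_univ_succ] at h0
    simp only [Λ, Ω, p, q, frameConn_succ_zero, frameConn_succ_succ, frameConn_zero_zero,
      frameCol_zero, frameCol_succ, Pi.zero_apply, Matrix.zero_apply, mul_zero, zero_mul, zero_add,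
      add_zero, sub_zero, one_mul, Finset.sum_const_zero] at h0
    simp only [Λ, Ω, frameConn_succ_zero, mul_comm (v τ l _)]
    linear_combination -h0

end StructureEquations

/-! ### Smoothness of the canonical d-connection -/

section Smoothness

theorem ContDiffOn.matrix_det {E : Type*} [NormedAddCommGroup E] [NormedSpace ℝ E] {k : ℕ}
    {U : Set E} {M : E → Matrix (Fin k) (Fin k) ℝ}
    (hM : ∀ i j, ContDiffOn ℝ ∞ (fun u => M u i j) U) : ContDiffOn ℝ ∞ (fun u => (M u).det) U := by
  simp only [Matrix.det_apply']
  exact ContDiffOn.sum fun σ _ => contDiffOn_const.mul (contDiffOn_prod fun i _ => hM _ _)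

/-- By Cramer's rule each entry is a quotient of determinants, the numerator being that of the
matrix with one row replaced by a constant one. -/
theorem ContDiffOn.matrix_inv {E : Type*} [NormedAddCommGroup E] [NormedSpace ℝ E] {k : ℕ}
    {U : Set E} {M : E → Matrix (Fin k) (Fin k) ℝ}
    (hM : ∀ i j, ContDiffOn ℝ ∞ (fun u => M u i j) U) (hdet : ∀ u ∈ U, (M u).det ≠ 0)
    (i j : Fin k) : ContDiffOn ℝ ∞ (fun u => (M u)⁻¹ i j) U := by
  simp only [Matrix.inv_def, Ring.inverse_eq_inv', Matrix.smul_apply, smul_eq_mul,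
    Matrix.adjugate_apply]
  refine ((ContDiffOn.matrix_det hM).inv hdet).mul (ContDiffOn.matrix_det fun a b => ?_)
  by_cases h : a = j
  · subst h
    simp only [Matrix.updateRow_self]
    exact contDiffOn_const
  · simp only [Matrix.updateRow_ne h]
    exact hM a b

variable {n m : ℕ} {U : Set (Coord n m)}

theorem contDiffOn_eH (hU : IsOpen U) {N : Coord n m → Matrix (Fin m) (Fin n) ℝ}
    (hN : ∀ a i, ContDiffOn ℝ ∞ (fun u => N u a i) U) (k : Fin n) {f : Coord n m → ℝ}
    (hf : ContDiffOn ℝ ∞ f U) : ContDiffOn ℝ ∞ (fun u => eH N k f u) U :=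
  (hf.fderiv_of_isOpen hU (m := ∞) (by simp)).clm_apply
    (contDiffOn_const.prodMk (contDiffOn_pi.2 fun a => (hN a k).neg))

theorem contDiffOn_eV (hU : IsOpen U) (c : Fin m) {f : Coord n m → ℝ} (hf : ContDiffOn ℝ ∞ f U) :
    ContDiffOn ℝ ∞ (fun u => eV c f u) U :=
  (hf.fderiv_of_isOpen hU (m := ∞) (by simp)).clm_apply contDiffOn_const

variable {N : Coord n m → Matrix (Fin m) (Fin n) ℝ} {g : Coord n m → Matrix (Fin n) (Fin n) ℝ}
  {h : Coord n m → Matrix (Fin m) (Fin m) ℝ}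

theorem contDiffOn_coefL (hU : IsOpen U) (hN : ∀ a i, ContDiffOn ℝ ∞ (fun u => N u a i) U)
    (hg : ∀ i j, ContDiffOn ℝ ∞ (fun u => g u i j) U) (hdet : ∀ u ∈ U, (g u).det ≠ 0)
    (i j k : Fin n) : ContDiffOn ℝ ∞ (fun u => coefL N g u i j k) U :=
  contDiffOn_const.mul <| ContDiffOn.sum fun r _ => (ContDiffOn.matrix_inv hg hdet i r).mul
    (((contDiffOn_eH hU hN k (hg j r)).add (contDiffOn_eH hU hN j (hg k r))).sub
      (contDiffOn_eH hU hN r (hg j k)))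

theorem contDiffOn_coefLv (hU : IsOpen U) (hN : ∀ a i, ContDiffOn ℝ ∞ (fun u => N u a i) U)
    (hh : ∀ i j, ContDiffOn ℝ ∞ (fun u => h u i j) U) (hdet : ∀ u ∈ U, (h u).det ≠ 0)
    (a b : Fin m) (k : Fin n) : ContDiffOn ℝ ∞ (fun u => coefLv N h u a b k) U :=
  (contDiffOn_eV hU b (hN a k)).add <| contDiffOn_const.mul <| ContDiffOn.sum fun c _ =>
    (ContDiffOn.matrix_inv hh hdet a c).mul
      (((contDiffOn_eH hU hN k (hh b c)).sub
        (ContDiffOn.sum fun d _ => (hh d c).mul (contDiffOn_eV hU b (hN d k)))).sub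
        (ContDiffOn.sum fun d _ => (hh d b).mul (contDiffOn_eV hU c (hN d k))))

theorem contDiffOn_coefCh (hU : IsOpen U)
    (hg : ∀ i j, ContDiffOn ℝ ∞ (fun u => g u i j) U) (hdet : ∀ u ∈ U, (g u).det ≠ 0)
    (i j : Fin n) (c : Fin m) : ContDiffOn ℝ ∞ (fun u => coefCh g u i j c) U :=
  contDiffOn_const.mul <| ContDiffOn.sum fun k _ => (ContDiffOn.matrix_inv hg hdet i k).mul
    (contDiffOn_eV hU c (hg j k))

theorem contDiffOn_coefC (hU : IsOpen U)
    (hh : ∀ i j, ContDiffOn ℝ ∞ (fun u => h u i j) U) (hdet : ∀ u ∈ U, (h u).det ≠ 0)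
    (a b c : Fin m) : ContDiffOn ℝ ∞ (fun u => coefC h u a b c) U :=
  contDiffOn_const.mul <| ContDiffOn.sum fun d _ => (ContDiffOn.matrix_inv hh hdet a d).mul
    (((contDiffOn_eV hU c (hh b d)).add (contDiffOn_eV hU b (hh c d))).sub
      (contDiffOn_eV hU d (hh b c)))

theorem contDiffOn_vertical (hN : ∀ a i, ContDiffOn ℝ ∞ (fun u => N u a i) U) (ξ : Coord n m)
    (a : Fin m) : ContDiffOn ℝ ∞ (fun u => (ξ.2 + (N u).mulVec ξ.1) a) U :=
  contDiffOn_const.add <| by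
    simp only [Matrix.mulVec, dotProduct]
    exact ContDiffOn.sum fun i _ => (hN a i).mul contDiffOn_const

theorem isLinearMap_vertical (M : Matrix (Fin m) (Fin n) ℝ) (a : Fin m) :
    IsLinearMap ℝ (fun ξ : Coord n m => (ξ.2 + M.mulVec ξ.1) a) := by
  refine ⟨fun ξ η => ?_, fun t ξ => ?_⟩
  · simp only [Prod.fst_add, Prod.snd_add, Matrix.mulVec_add, Pi.add_apply]
    ring
  · simp only [Prod.smul_fst, Prod.smul_snd, Matrix.mulVec_smul, Pi.add_apply, Pi.smul_apply,
      smul_eq_mul]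
    ring

theorem isLinearMap_conn (M : Matrix (Fin m) (Fin n) ℝ) (α : Fin n → ℝ) (β : Fin m → ℝ) :
    IsLinearMap ℝ (fun ξ : Coord n m => (∑ k, α k * ξ.1 k)
      + ∑ c, β c * (ξ.2 + M.mulVec ξ.1) c) := by
  refine ⟨fun ξ η => ?_, fun t ξ => ?_⟩
  · have h := fun c => (isLinearMap_vertical M c).map_add ξ η
    beta_reduce at h
    simp only [h, mul_add, Finset.sum_add_distrib]
    simp only [Prod.fst_add, Pi.add_apply, mul_add, Finset.sum_add_distrib]
    ring
  · have h := fun c => (isLinearMap_vertical M c).map_smul t ξ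
    beta_reduce at h
    simp only [h, smul_eq_mul, mul_left_comm _ t, ← Finset.mul_sum]
    simp only [Prod.smul_fst, Pi.smul_apply, smul_eq_mul, mul_left_comm _ t, ← Finset.mul_sum,
      mul_add]

variable {V : Type*} [TopologicalSpace V] [ChartedSpace (Coord n m) V]

theorem NAnholonomic.hBlock_isSmoothOn (M : NAnholonomic n m V) {φ : LChart n m V}
    (hφ : φ ∈ atlas (Coord n m) V) : (M.hBlock φ).IsSmoothOn φ.target := by
  have hU := φ.open_target
  have hN := M.smooth_N φ hφ
  have hg := M.smooth_g φ hφ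
  have hdet : ∀ u ∈ φ.target, (M.g φ u).det ≠ 0 := fun u hu => (M.posDef_g φ hφ u hu).det_pos.ne'
  exact
  { linear_θ := fun u i => ⟨fun ξ η => rfl, fun t ξ => rfl⟩
    linear_conn := fun u i j => isLinearMap_conn (M.N φ u) _ _
    smooth_θ := fun ξ i => contDiffOn_const
    smooth_conn := fun ξ i j =>
      (ContDiffOn.sum fun k _ => (contDiffOn_coefL hU hN hg hdet i j k).mul contDiffOn_const).add
        (ContDiffOn.sum fun c _ => (contDiffOn_coefCh hU hg hdet i j c).mul
          (contDiffOn_vertical hN ξ c))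
    smooth_met := hg }

theorem NAnholonomic.vBlock_isSmoothOn (M : NAnholonomic n m V) {φ : LChart n m V}
    (hφ : φ ∈ atlas (Coord n m) V) : (M.vBlock φ).IsSmoothOn φ.target := by
  have hU := φ.open_target
  have hN := M.smooth_N φ hφ
  have hh := M.smooth_h φ hφ
  have hdet : ∀ u ∈ φ.target, (M.h φ u).det ≠ 0 := fun u hu => (M.posDef_h φ hφ u hu).det_pos.ne'
  exact
  { linear_θ := fun u i => isLinearMap_vertical (M.N φ u) i
    linear_conn := fun u i j => isLinearMap_conn (M.N φ u) _ _
    smooth_θ := fun ξ i => contDiffOn_vertical hN ξ i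
    smooth_conn := fun ξ i j =>
      (ContDiffOn.sum fun k _ => (contDiffOn_coefLv hU hN hh hdet i j k).mul contDiffOn_const).add
        (ContDiffOn.sum fun c _ => (contDiffOn_coefC hU hh hdet i j c).mul
          (contDiffOn_vertical hN ξ c))
    smooth_met := hh }

end Smoothness

/-! ### The Hamiltonian form of the flow equations -/

section HamiltonianForm

variable {n m : ℕ} {V : Type*} [TopologicalSpace V] [ChartedSpace (Coord n m) V]
  {r : ℕ}
  {B : LChart n m V → DBlock n m (r + 1)} {R : ℝ} {I : Set ℝ} {γ : ℝ → ℝ → V}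
  {e : LChart n m V → Fin (r + 1) → ℝ → ℝ → Fin (r + 1) → ℝ} {v perp : ℝ → SField r}
  {ϖ : ℝ → ℝ → Vec r} {par : ℝ → ℝ → ℝ} {Θ : ℝ → ℝ → Matrix (Fin r) (Fin r) ℝ}

theorem isOpen_flow_preimage (hI : IsOpen I)
    (hγ : ContMDiffOn 𝓘(ℝ, ℝ × ℝ) 𝓘(ℝ, Coord n m) ∞ (fun z : ℝ × ℝ => γ z.1 z.2)
      (I ×ˢ Set.univ)) (φ : LChart n m V) :
    IsOpen {z : ℝ × ℝ | z.1 ∈ I ∧ γ z.1 z.2 ∈ φ.source} := by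
  have h := hγ.continuousOn.isOpen_inter_preimage (hI.prod isOpen_univ) φ.open_source
  convert h using 1
  ext z
  simp

variable [IsManifold 𝓘(ℝ, Coord n m) ∞ V]

theorem smoothOn₂_chart_flow (hγ : ContMDiffOn 𝓘(ℝ, ℝ × ℝ) 𝓘(ℝ, Coord n m) ∞
    (fun z : ℝ × ℝ => γ z.1 z.2) (I ×ˢ Set.univ)) {φ : LChart n m V}
    (hφ : φ ∈ atlas (Coord n m) V) :
    SmoothOn₂ {z : ℝ × ℝ | z.1 ∈ I ∧ γ z.1 z.2 ∈ φ.source} (fun τ l => φ (γ τ l)) := by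
  have hchart : ContMDiffOn 𝓘(ℝ, Coord n m) 𝓘(ℝ, Coord n m) ∞ φ φ.source :=
    contMDiffOn_of_mem_maximalAtlas (IsManifold.subset_maximalAtlas hφ)
  exact (hchart.comp (hγ.mono fun z hz => ⟨hz.1, Set.mem_univ _⟩) fun z hz => hz.2).contDiffOn

/-- The equations no longer mention the chart, so at each `(τ, l)` the chart around `γ(τ, l)` may be
used; hence they hold on the whole line, although a curve need not lie in one chart. -/
theorem IsCurveFlow.structure_equations_at (h : IsCurveFlow B R I γ e v perp ϖ par Θ)
    (hB : ∀ φ ∈ atlas (Coord n m) V, (B φ).IsSmoothOn φ.target) {τ : ℝ} (hτ : τ ∈ I) (l : ℝ) :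
    HasDerivAt (par τ) (∑ j, v τ l j * perp τ l j) l ∧
    (∀ j, ϖ τ l j = deriv (perp τ) l j + par τ l * v τ l j) ∧
    (∀ i j, HasDerivAt (fun s => Θ τ s i j) (ϖ τ l i * v τ l j - v τ l i * ϖ τ l j) l) ∧
    ∀ j, ∃ d, HasDerivAt (fun s => ϖ τ s j) d l ∧
      HasDerivAt (fun s => v s l j) (d - ∑ i, v τ l i * Θ τ l i j - R * perp τ l j) τ :=
  h.structure_equations (chart_mem_atlas _ (γ τ l)) (hB _ (chart_mem_atlas _ (γ τ l))) rfl
    (isOpen_flow_preimage h.isOpen h.smooth _) (smoothOn₂_chart_flow h.smooth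
      (chart_mem_atlas _ (γ τ l))) ⟨hτ, mem_chart_source _ (γ τ l)⟩

theorem inner_eq_sum_mul {k : ℕ} (a b : Vec k) : inner ℝ a b = ∑ j, a j * b j := by
  simp [PiLp.inner_apply, mul_comm]

theorem hasDerivAt_of_apply {k : ℕ} {f : ℝ → Vec k} {f' : Vec k} {t : ℝ}
    (h : ∀ j, HasDerivAt (fun s => f s j) (f' j) t) : HasDerivAt f f' t :=
  ((EuclideanSpace.equiv (Fin k) ℝ).symm : (Fin k → ℝ) →L[ℝ] Vec k).hasFDerivAt.comp_hasDerivAt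
    (f := fun s => (f s).ofLp) t (hasDerivAt_pi.2 h)

/-- The structure equations determine `e_∥` and `Θ` up to functions of `τ`, and the normalizations
select the antiderivatives that occur in `J` and `H`. -/
theorem IsCurveFlow.hamiltonianFlow (h : IsCurveFlow B R I γ e v perp ϖ par Θ)
    (hB : ∀ φ ∈ atlas (Coord n m) V, (B φ).IsSmoothOn φ.target) :
    HamiltonianFlow R I v perp ϖ := by
  refine ⟨fun τ => opJ (v τ) (perp τ), fun τ hτ => ?_⟩
  have hpar : ∀ l, antideriv (dotField (v τ) (perp τ)) l = par τ l :=
    antideriv_eq_of_hasDerivAt (fun l => by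
      rw [dotField_apply, inner_eq_sum_mul]
      exact (h.structure_equations_at hB hτ l).1) (h.normalized_par τ hτ)
  have hϖ : ∀ l, ϖ τ l = opJ (v τ) (perp τ) l := fun l => by
    ext j
    rw [(h.structure_equations_at hB hτ l).2.1 j, opJ_apply, hpar]
    rfl
  -- The matrix entries of `v ∧ ϖ` are `v_i ϖ_j - ϖ_i v_j`, the negative of the `l`-derivative of
  -- `Θ_ij`; hence the sign.
  have hΘ : ∀ l i j, antideriv (wedgeField (v τ) (opJ (v τ) (perp τ))) l
      (EuclideanSpace.single i 1) j = -Θ τ l i j := fun l i j => by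
    let L : (Vec r →L[ℝ] Vec r) →L[ℝ] ℝ := (EuclideanSpace.proj j).comp
      (ContinuousLinearMap.apply ℝ (Vec r) (EuclideanSpace.single i 1))
    refine (L.antideriv_postcomp (wedgeField (v τ) (opJ (v τ) (perp τ))) l).symm.trans ?_
    refine antideriv_eq_of_hasDerivAt (Φ := fun s => -Θ τ s i j) (fun s => ?_) ?_ l
    · refine ((h.structure_equations_at hB hτ s).2.2.1 i j).fun_neg.congr_deriv ?_
      rw [hϖ]
      change _ = wedge (v τ s) (opJ (v τ) (perp τ) s) (EuclideanSpace.single i 1) j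
      simp [wedge_apply, EuclideanSpace.inner_single_right]
    · have := (h.normalized_rot τ hτ i j).neg
      rw [neg_zero] at this
      exact this.congr fun s => neg_add _ _
  have hv : ∀ l, HasDerivAt (fun s => v s l)
      ((opH (v τ) (opJ (v τ) (perp τ)) - R • perp τ) l) τ := fun l => by
    refine hasDerivAt_of_apply fun j => ?_
    obtain ⟨d, hd, hvd⟩ := (h.structure_equations_at hB hτ l).2.2.2 j
    refine hvd.congr_deriv ?_
    have hd' : d = deriv (opJ (v τ) (perp τ)) l j := by
      simp only [hϖ] at hd
      exact hd.unique ((EuclideanSpace.proj (𝕜 := ℝ) j).hasFDerivAt.comp_hasDerivAt l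
        ((opJ (v τ) (perp τ)).hasDerivAt l))
    -- Expanding `v` in the standard basis turns the rotation term `vΘ` of the curvature equation
    -- into the nonlocal term of `H`.
    have hrot : antideriv (wedgeField (v τ) (opJ (v τ) (perp τ))) l (v τ l) j
        = -∑ i, v τ l i * Θ τ l i j := by
      have hsum : v τ l = ∑ i, v τ l i • EuclideanSpace.single i (1 : ℝ) := by
        ext a
        simp [Pi.single_apply]
      conv_lhs => rw [hsum]
      simp [map_sum, hΘ]
    rw [sub_apply, opH_apply, smul_apply, hd']
    change _ = deriv (opJ (v τ) (perp τ)) l j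
      + antideriv (wedgeField (v τ) (opJ (v τ) (perp τ))) l (v τ l) j - R * perp τ l j
    rw [hrot]
    ring
  -- The two forms of the equation coincide, since `ℜ` is by definition `H ∘ J`.
  exact ⟨hϖ, rfl, hv, hv⟩

end HamiltonianForm

/-! ### The theorem on pairs of operators and on horizontal and vertical flows -/

theorem mainTheorem2 (p q : ℕ) :
    -- the d-operators are invariant under `(O(n-1), O(m-1))`, where `n = p + 1` and `m = q + 1`
    (∀ (A : Vec p ≃ₗᵢ[ℝ] Vec p) (B : Vec q ≃ₗᵢ[ℝ] Vec q) (v X : DField p q),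
      dJ (dAct A B v) (dAct A B X) = dAct A B (dJ v X) ∧
      dH (dAct A B v) (dAct A B X) = dAct A B (dH v X)) ∧
    -- they are a symplectic and a cosymplectic operator
    IsSymplecticOperator (dPair (p := p) (q := q)) dJ ∧
    IsCosymplecticOperator (dPair (p := p) (q := q)) dDomH dH ∧
    -- the recursion operator is the composition, and it is hereditary
    (∀ v X : DField p q, dR v X = dH v (dJ v X)) ∧
    IsHereditaryOperator (fun v : DField p q => {X | dJ v X ∈ dDomH v}) dR ∧
    -- the h-flows and the v-flows have Hamiltonian form
    (∀ (V : Type*) [TopologicalSpace V] [ChartedSpace (Coord (p + 1) (q + 1)) V]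
      [IsManifold 𝓘(ℝ, Coord (p + 1) (q + 1)) ∞ V] (M : NAnholonomic (p + 1) (q + 1) V)
      (I : Set ℝ) (γ : ℝ → ℝ → V),
      (∀ (R : ℝ) (e : LChart (p + 1) (q + 1) V → Fin (p + 1) → ℝ → ℝ → Fin (p + 1) → ℝ)
        (v perp : ℝ → SField p) (ϖ : ℝ → ℝ → Vec p) (par : ℝ → ℝ → ℝ)
        (Θ : ℝ → ℝ → Matrix (Fin p) (Fin p) ℝ),
        IsCurveFlow M.hBlock R I γ e v perp ϖ par Θ → HamiltonianFlow R I v perp ϖ) ∧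
      (∀ (S : ℝ) (e : LChart (p + 1) (q + 1) V → Fin (q + 1) → ℝ → ℝ → Fin (q + 1) → ℝ)
        (v perp : ℝ → SField q) (ϖ : ℝ → ℝ → Vec q) (par : ℝ → ℝ → ℝ)
        (Θ : ℝ → ℝ → Matrix (Fin q) (Fin q) ℝ),
        IsCurveFlow M.vBlock S I γ e v perp ϖ par Θ → HamiltonianFlow S I v perp ϖ)) := by
  refine ⟨fun A B v X => ⟨Prod.ext (opJ_rotate A _ _) (opJ_rotate B _ _),
      Prod.ext (opH_rotate A _ _) (opH_rotate B _ _)⟩, isSymplecticOperator_dJ,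
    isCosymplecticOperator_dH, fun v X => rfl, isHereditaryOperator_dR, ?_⟩
  intro V _ _ _ M I γ
  exact ⟨fun R e v perp ϖ par Θ h => h.hamiltonianFlow fun φ hφ => M.hBlock_isSmoothOn hφ,
    fun S e v perp ϖ par Θ h => h.hamiltonianFlow fun φ hφ => M.vBlock_isSmoothOn hφ⟩
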